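/- **Theorem ($k$-rectangle factorization).** Let $n\ge 2$ and $k=n-1$. Let $R(T)=\mathbb{Z}[e^{\pm a_1},\dots,e^{\pm a_n}]/(e^{a_1+\cdots+a_n}-1)$, put $b_j=1-e^{-a_j}$, and let $\hat\Lambda^{R(T)}$ be the ring of symmetric formal power series in $y=(y_1,y_2,\dots)$ with coefficients in $R(T)$. Indices of $a_j,b_j$ are read modulo $n$. Put $$\Omega(b_j|y)=\prod_{l\ge1}\frac{1}{1-b_jy_l}.$$ For $1\le i\le n-1$ let $s_i$ act on $\hat\Lambda^{R(T)}$ by exchanging $a_i$ and $a_{i+1}$ in the coefficients, and let $s_0(f)=\frac{\Omega(b_1|y)}{\Omega(b_n|y)}\,s_\theta(f)$, where $s_\theta$ exchanges $a_1$ and $a_n$ in the coefficients. With $\alpha_i=a_i-a_{i+1}$ for $1\le i\le n-1$ and $\alpha_0=a_n-a_1$, the Demazure operators on $\hat\Lambda^{R(T)}$ are $$D_i=(1-e^{\alpha_i})^{-1}(s_i-1)+1\qquad(0\le i\le n-1).$$ For $w$ in the affine Weyl group of type $A^{(1)}_{n-1}$ with simple reflections $s_0,\dots,s_{n-1}$,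 let $D_w=D_{i_1}\cdots D_{i_l}$ for a reduced expression $w=s_{i_1}\cdots s_{i_l}$. A partition $\lambda=(\lambda_1\ge\lambda_2\ge\cdots)$ is $k$-bounded if $\lambda_1\le k$. To such $\lambda$ corresponds the affine Grassmannian element $w_\lambda$, the product of the simple reflections $s_{c-r \bmod n}$ over the boxes $(r,c)$ (row $r$, column $c$) of $\lambda$, written from left to right by reading the rows from the bottom one to the top one and each row from right to left. The closed $K$-theoretic double $k$-Schur function is $$\tilde g^{(k)}_\lambda(y|b)=D_{w_\lambda}(1)\in\hat\Lambda^{R(T)}.$$ For $1\le i\le n-1$ let $R_i=(i)^{n-i}$ be the partition with $n-i$ parts equal to $i$, and let $\lambda\cup R_i$ be the partition whose parts are those of $\lambda$ together with those of $R_i$. For $f(y|b)\in\hat\Lambda^{R(T)}$ let $f(y|\omega^ib)$ denote the series obtained by replacing $a_j$ by $a_{j+i}$ (hence $b_j$ by $b_{j+i}$) for every $j$ in the coefficients. Then for every $k$-bounded partition $\lambda$ and every $1\le i\le n-1$, $$\tilde g^{(k)}_{\lambda\cup R_i}(y|b)=\tilde g^{(k)}_{\lambda}(y|\omega^i b)\cdot\tilde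 g^{(k)}_{R_i}(y|b).$$ -/

import Mathlib

noncomputable section

namespace KSchur

/-! ### The representation ring of the maximal torus of `SL_n`

The indices `1, …, n` are read modulo `n`, so that `a_n` is `a 0`. -/

/-- The weight lattice `(ℤ a_1 ⊕ ⋯ ⊕ ℤ a_n) / ℤ (a_1 + ⋯ + a_n)`. -/
abbrev WeightLattice (n : ℕ) : Type :=
  (ZMod n → ℤ) ⧸ AddSubgroup.zmultiples (1 : ZMod n → ℤ)

/-- The class of the basis vector `a_j`. -/
def weight (n : ℕ) (j : ZMod n) : WeightLattice n :=
  QuotientAddGroup.mk (Pi.single j 1)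

/-- `R(T) = ℤ[e^{±a_1}, …, e^{±a_n}] / (e^{a_1 + ⋯ + a_n} - 1)`, the group ring of the weight
lattice. -/
abbrev RepRing (n : ℕ) : Type := AddMonoidAlgebra ℤ (WeightLattice n)

/-- The element `e^μ` of `R(T)`. -/
def expWt {n : ℕ} (μ : WeightLattice n) : RepRing n := AddMonoidAlgebra.single μ 1

/-- The equivariant parameter `b_j = 1 - e^{-a_j}`. -/
def bParam (n : ℕ) (j : ZMod n) : RepRing n := 1 - expWt (-weight n j)

/-- `α_j = a_j - a_{j+1}`; for `j = 0` this is the level zero root `α_0 = a_n - a_1 = -θ`. -/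
def root (n : ℕ) (j : ZMod n) : WeightLattice n := weight n j - weight n (j + 1)

/-- A permutation `p` of the indices acts on weights by `a_j ↦ a_{p j}`. -/
def permWeight {n : ℕ} (p : Equiv.Perm (ZMod n)) : WeightLattice n →+ WeightLattice n :=
  QuotientAddGroup.map _ _
    { toFun := fun μ => μ ∘ p.symm
      map_zero' := rfl
      map_add' := fun _ _ => rfl }
    (by
      rintro _ ⟨c, rfl⟩
      exact ⟨c, rfl⟩)

/-- A permutation `p` of the indices acts on `R(T)` by `e^{a_j} ↦ e^{a_{p j}}`. -/
def permRep {n : ℕ} (p : Equiv.Perm (ZMod n)) : RepRing n →+* RepRing n :=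
  AddMonoidAlgebra.mapDomainRingHom ℤ (permWeight p)

theorem permWeight_weight {n : ℕ} (p : Equiv.Perm (ZMod n)) (j : ZMod n) :
    permWeight p (weight n j) = weight n (p j) := by
  have h : (Pi.single j (1 : ℤ) : ZMod n → ℤ) ∘ p.symm = Pi.single (p j) 1 := by
    funext x
    by_cases hx : x = p j
    · subst hx; simp
    · have : p.symm x ≠ j := fun h => hx (by rw [← h]; simp)
      simp [hx, this]
  exact congrArg (QuotientAddGroup.mk (s := AddSubgroup.zmultiples (1 : ZMod n → ℤ))) h

theorem permRep_expWt {n : ℕ} (p : Equiv.Perm (ZMod n)) (μ : WeightLattice n) :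
    permRep p (expWt μ) = expWt (permWeight p μ) := by
  simp [permRep, expWt]

theorem expWt_add {n : ℕ} (μ ν : WeightLattice n) : expWt (μ + ν) = expWt μ * expWt ν := by
  simp [expWt, AddMonoidAlgebra.single_mul_single]

theorem expWt_zero {n : ℕ} : expWt (0 : WeightLattice n) = 1 := rfl

theorem permWeight_swap {n : ℕ} [Fact (1 < n)] (i : ZMod n) (v : ZMod n → ℤ) :
    permWeight (Equiv.swap i (i + 1)) (QuotientAddGroup.mk v) =
      QuotientAddGroup.mk v - (v i - v (i + 1)) • root n i := by
  have hne : i ≠ i + 1 := by simp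
  have h : v ∘ (Equiv.swap i (i + 1)).symm =
      v - (v i - v (i + 1)) • (Pi.single i 1 - Pi.single (i + 1) 1) := by
    funext x
    by_cases h1 : x = i
    · subst h1; simp
    · by_cases h2 : x = i + 1
      · subst h2; simp
      · simp [Equiv.swap_apply_of_ne_of_ne h1 h2, h1, h2]
  exact congrArg (QuotientAddGroup.mk (s := AddSubgroup.zmultiples (1 : ZMod n → ℤ))) h

theorem dvd_expWt_zsmul_sub_one {n : ℕ} (μ : WeightLattice n) (c : ℤ) :
    (1 - expWt μ) ∣ (expWt (c • μ) - 1) := by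
  have key : ∀ (m : ℕ) (ν : WeightLattice n), (1 - expWt ν) ∣ (expWt (m • ν) - 1) := by
    intro m ν
    have : expWt (m • ν) = expWt ν ^ m := by
      induction m with
      | zero => simp [expWt_zero]
      | succ k ih => rw [succ_nsmul, expWt_add, ih, pow_succ]
    rw [this, ← neg_dvd, neg_sub]
    simpa using sub_dvd_pow_sub_pow (expWt ν) 1 m
  have hneg : (1 - expWt μ) ∣ (1 - expWt (-μ)) := by
    refine ⟨-expWt (-μ), ?_⟩
    have : expWt μ * expWt (-μ) = 1 := by rw [← expWt_add, add_neg_cancel, expWt_zero]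
    linear_combination -this
  obtain ⟨m, rfl | rfl⟩ := c.eq_nat_or_neg
  · simpa using key m μ
  · have := key m (-μ)
    have e : m • (-μ) = (-(m : ℤ)) • μ := by simp
    rw [e] at this
    exact hneg.trans this

/-- `1 - e^{α_i}` divides `s_i(r) - r` in `R(T)`. -/
theorem dvd_permRep_sub {n : ℕ} [Fact (1 < n)] (i : ZMod n) (r : RepRing n) :
    (1 - expWt (root n i)) ∣ (permRep (Equiv.swap i (i + 1)) r - r) := by
  induction r using AddMonoidAlgebra.induction_linear with
  | zero => simp
  | add f g hf hg =>
    rw [map_add, add_sub_add_comm]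
    exact dvd_add hf hg
  | single μ c =>
    induction μ using QuotientAddGroup.induction_on with
    | H v =>
      have hs : (AddMonoidAlgebra.single (QuotientAddGroup.mk v) c : RepRing n) =
          c • expWt (QuotientAddGroup.mk v) := by simp [expWt]
      rw [hs, map_zsmul, ← smul_sub, permRep_expWt, permWeight_swap, sub_eq_add_neg _ (_ • _),
        expWt_add, ← neg_smul, ← mul_sub_one]
      rw [zsmul_eq_mul]
      exact ((dvd_expWt_zsmul_sub_one _ _).mul_left _).mul_left _

/-! ### Symmetric formal power series -/

/-- The ring of symmetric formal power series in `y_1, y_2, …` with coefficients in `R(T)`. -/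
def SymSeries (n : ℕ) : Subalgebra (RepRing n) (MvPowerSeries ℕ (RepRing n)) where
  carrier := {f | ∀ e : Equiv.Perm ℕ, MvPowerSeries.renameEquiv (RepRing n) e f = f}
  mul_mem' := fun hf hg e => by rw [map_mul, hf e, hg e]
  add_mem' := fun hf hg e => by rw [map_add, hf e, hg e]
  algebraMap_mem' := fun r e => AlgEquiv.commutes _ r

theorem coeff_renameEquiv {n : ℕ} (e : Equiv.Perm ℕ) (f : MvPowerSeries ℕ (RepRing n))
    (m : ℕ →₀ ℕ) :
    MvPowerSeries.coeff m (MvPowerSeries.renameEquiv (RepRing n) e f) =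
      MvPowerSeries.coeff (Finsupp.mapDomain e.symm m) f := by
  have h := MvPowerSeries.coeff_embDomain_rename e.toEmbedding f (Finsupp.mapDomain e.symm m)
  have h2 : Finsupp.embDomain e.toEmbedding (Finsupp.mapDomain e.symm m) = m := by
    rw [Finsupp.embDomain_eq_mapDomain, ← Finsupp.mapDomain_comp]
    simp [Finsupp.mapDomain_id]
  rw [h2] at h
  exact h

theorem mem_SymSeries_iff {n : ℕ} (f : MvPowerSeries ℕ (RepRing n)) :
    f ∈ SymSeries n ↔ ∀ (e : Equiv.Perm ℕ) (m : ℕ →₀ ℕ),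
      MvPowerSeries.coeff (Finsupp.mapDomain e m) f = MvPowerSeries.coeff m f := by
  constructor
  · intro h e m
    have := congrArg (MvPowerSeries.coeff m) (h e.symm)
    rwa [coeff_renameEquiv] at this
  · intro h e
    ext m
    rw [coeff_renameEquiv, h]

/-- A permutation `p` of the indices acts on symmetric series through the coefficients, by
`e^{a_j} ↦ e^{a_{p j}}`; in particular `f(y|b)` is sent to `f(y|p b)`. -/
def permSeries {n : ℕ} (p : Equiv.Perm (ZMod n)) : SymSeries n →+* SymSeries n :=
  ((MvPowerSeries.map (permRep p)).comp (SymSeries n).val.toRingHom).codRestrict (SymSeries n)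
    (fun f => (mem_SymSeries_iff _).2 fun e m => by
      have := (mem_SymSeries_iff _).1 f.2 e m
      simp [this])

/-- The cyclic permutation `j ↦ j + 1` of the indices. -/
def cyc (n : ℕ) : Equiv.Perm (ZMod n) := Equiv.addRight 1

theorem degree_mapDomain_perm (e : Equiv.Perm ℕ) (m : ℕ →₀ ℕ) :
    (Finsupp.mapDomain e m).degree = m.degree := by
  simp [Finsupp.degree_mapDomain]

/-- `Ω(b_j|y) = ∏_{l ≥ 1} (1 - b_j y_l)⁻¹`: expanding the geometric series, the coefficient of each
monomial of degree `d` is `b_j ^ d`. -/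
def Omega (n : ℕ) (j : ZMod n) : SymSeries n :=
  ⟨fun m => bParam n j ^ m.degree, (mem_SymSeries_iff _).2 fun e m => by
    change bParam n j ^ (Finsupp.mapDomain e m).degree = bParam n j ^ m.degree
    rw [degree_mapDomain_perm]⟩

theorem isUnit_Omega (n : ℕ) (j : ZMod n) : IsUnit (Omega n j) := by
  set u : MvPowerSeries ℕ (RepRing n) := (Omega n j).1 with hu
  have hc : MvPowerSeries.constantCoeff u = ((1 : (RepRing n)ˣ) : RepRing n) := by
    change bParam n j ^ (0 : ℕ →₀ ℕ).degree = _
    simp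
  set v := MvPowerSeries.invOfUnit u 1 with hv
  have huv : u * v = 1 := MvPowerSeries.mul_invOfUnit u 1 hc
  have hvmem : v ∈ SymSeries n := by
    intro e
    have h1 := congrArg (MvPowerSeries.renameEquiv (RepRing n) e) huv
    rw [map_mul, map_one, (Omega n j).2 e] at h1
    calc _ = (u * v) * MvPowerSeries.renameEquiv (RepRing n) e v := by rw [huv, one_mul]
      _ = v * (u * MvPowerSeries.renameEquiv (RepRing n) e v) := by ring
      _ = v := by rw [h1, mul_one]
  exact IsUnit.of_mul_eq_one ⟨v, hvmem⟩ (Subtype.ext huv)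

/-! ### Demazure operators -/

/-- The action of the affine simple reflection `s_i` on symmetric series: for `i ≠ 0` it exchanges
`a_i` and `a_{i+1}`, and `s_0(f) = Ω(b_1|y) / Ω(b_n|y) · s_θ(f)` where `s_θ` exchanges `a_n` and
`a_1`. -/
def simpleAct (n : ℕ) (i : ZMod n) (f : SymSeries n) : SymSeries n :=
  if i = 0 then Omega n 1 * Ring.inverse (Omega n 0) * permSeries (Equiv.swap 0 1) f
  else permSeries (Equiv.swap i (i + 1)) f

theorem exists_smul_of_dvd_coeff {n : ℕ} (d : RepRing n) (f : SymSeries n)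
    (h : ∀ m, d ∣ MvPowerSeries.coeff m f.1) : ∃ g : SymSeries n, d • g = f := by
  classical
  let q : RepRing n → RepRing n := fun r => if hr : d ∣ r then hr.choose else 0
  have hq : ∀ r, d ∣ r → d * q r = r := fun r hr => by
    simp only [q, dif_pos hr]; exact hr.choose_spec.symm
  refine ⟨⟨fun m => q (MvPowerSeries.coeff m f.1), (mem_SymSeries_iff _).2 fun e m => ?_⟩, ?_⟩
  · exact congrArg q ((mem_SymSeries_iff _).1 f.2 e m)
  · apply Subtype.ext
    ext1 m
    exact hq _ (h m)

theorem exists_smul_permSeries_sub {n : ℕ} [Fact (1 < n)] (i : ZMod n) (f : SymSeries n) :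
    ∃ g : SymSeries n,
      (1 - expWt (root n i)) • g = permSeries (Equiv.swap i (i + 1)) f - f :=
  exists_smul_of_dvd_coeff _ _ fun m => by
    have : MvPowerSeries.coeff m (permSeries (Equiv.swap i (i + 1)) f - f : SymSeries n).1 =
        permRep (Equiv.swap i (i + 1)) (MvPowerSeries.coeff m f.1) - MvPowerSeries.coeff m f.1 := by
      simp [permSeries]
    rw [this]
    exact dvd_permRep_sub i _

theorem exists_smul_Omega_sub (n : ℕ) :
    ∃ g : SymSeries n, (1 - expWt (root n 0)) • g = Omega n 1 - Omega n 0 :=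
  exists_smul_of_dvd_coeff _ _ fun m => by
    change _ ∣ bParam n 1 ^ m.degree - bParam n 0 ^ m.degree
    refine dvd_trans ?_ (sub_dvd_pow_sub_pow _ _ _)
    refine ⟨expWt (-weight n 0), ?_⟩
    have h : expWt (root n 0) * expWt (-weight n 0) = expWt (-weight n 1) := by
      rw [← expWt_add, root, zero_add]; congr 1; abel
    simp only [bParam]
    linear_combination h

/-- `s_i(f) - f` is divisible by `1 - e^{α_i}` in the ring of symmetric series. -/
theorem exists_smul_simpleAct_sub {n : ℕ} [Fact (1 < n)] (i : ZMod n) (f : SymSeries n) :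
    ∃ g : SymSeries n, (1 - expWt (root n i)) • g = simpleAct n i f - f := by
  obtain ⟨g, hg⟩ := exists_smul_permSeries_sub i f
  by_cases hi : i = 0
  · subst hi
    obtain ⟨o, ho⟩ := exists_smul_Omega_sub n
    have hinv := Ring.mul_inverse_cancel _ (isUnit_Omega n 0)
    rw [zero_add] at hg
    refine ⟨Omega n 1 * Ring.inverse (Omega n 0) * g + o * Ring.inverse (Omega n 0) * f, ?_⟩
    rw [simpleAct, if_pos rfl, smul_add, ← mul_smul_comm, hg, mul_assoc o, ← smul_mul_assoc, ho]
    linear_combination (-f) * hinv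
  · rw [simpleAct, if_neg hi]
    exact ⟨g, hg⟩

theorem torsionFree_weightLattice (n : ℕ) [Fact (1 < n)] : IsAddTorsionFree (WeightLattice n) := by
  refine ⟨fun m hm x y hxy => ?_⟩
  induction x using QuotientAddGroup.induction_on with
  | H v =>
    induction y using QuotientAddGroup.induction_on with
    | H w =>
      change (QuotientAddGroup.mk (m • v) : WeightLattice n) = QuotientAddGroup.mk (m • w) at hxy
      rw [QuotientAddGroup.eq] at hxy ⊢
      obtain ⟨c, hc⟩ := hxy
      refine ⟨(-v + w) 0, ?_⟩
      funext j
      have h0 := congrFun hc 0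
      have hj := congrFun hc j
      simp at h0 hj ⊢
      have : (m : ℤ) * (-v 0 + w 0) = m * (-v j + w j) := by
        linear_combination hj - h0
      exact mul_left_cancel₀ (by exact_mod_cast hm) this

/-- The quotient of `f` by `1 - e^{α_i}`, if it exists, is unique. -/
theorem smul_root_injective (n : ℕ) [Fact (1 < n)] (i : ZMod n) :
    Function.Injective fun g : SymSeries n => (1 - expWt (root n i)) • g := by
  have : NeZero n := ⟨by have := Fact.out (p := 1 < n); omega⟩
  have : IsAddTorsionFree (WeightLattice n) := torsionFree_weightLattice n
  have : AddMonoid.FG (WeightLattice n) := by infer_instance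
  have hne : (1 - expWt (root n i) : RepRing n) ≠ 0 := by
    intro h
    have h1 : (AddMonoidAlgebra.single 0 1 : RepRing n) = AddMonoidAlgebra.single (root n i) 1 :=
      sub_eq_zero.1 h
    have h2 : (0 : WeightLattice n) = root n i :=
      AddMonoidAlgebra.single_left_injective one_ne_zero h1
    change (QuotientAddGroup.mk 0 : WeightLattice n) =
      QuotientAddGroup.mk (Pi.single i 1 - Pi.single (i + 1) 1) at h2
    rw [QuotientAddGroup.eq] at h2
    obtain ⟨c, hc⟩ := h2
    have e1 := congrFun hc i
    have e2 := congrFun hc (i + 1)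
    simp at e1 e2
    omega
  intro g g' h
  apply Subtype.ext
  ext1 m
  have := congrArg (fun x : SymSeries n => MvPowerSeries.coeff m x.1) h
  exact mul_left_cancel₀ hne this

/-- The operator `T_i = (1 - e^{α_i})⁻¹ (s_i - 1)`. -/
def demazureT {n : ℕ} [Fact (1 < n)] (i : ZMod n) (f : SymSeries n) : SymSeries n :=
  (exists_smul_simpleAct_sub i f).choose

theorem demazureT_spec {n : ℕ} [Fact (1 < n)] (i : ZMod n) (f : SymSeries n) :
    (1 - expWt (root n i)) • demazureT i f = simpleAct n i f - f :=
  (exists_smul_simpleAct_sub i f).choose_spec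

/-- The Demazure operator `D_i = T_i + 1`. -/
def demazure {n : ℕ} [Fact (1 < n)] (i : ZMod n) (f : SymSeries n) : SymSeries n :=
  demazureT i f + f

/-! ### The affine Weyl group of type `A_{n-1}^{(1)}` -/

/-- The simple reflection `s_i` as a permutation of `ℤ`: it exchanges `j` and `j + 1` for every
`j ≡ i` modulo `n`. -/
def simpleRefl {n : ℕ} [Fact (1 < n)] (i : ZMod n) : Equiv.Perm ℤ :=
  Function.Involutive.toPerm
    (fun j : ℤ => if (j : ZMod n) = i then j + 1 else if (j : ZMod n) = i + 1 then j - 1 else j)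
    (by
      intro j
      by_cases h1 : (j : ZMod n) = i
      · simp [h1]
      · by_cases h2 : (j : ZMod n) = i + 1
        · simp [h2]
        · simp [h1, h2])

/-- The affine Weyl group, realized as the group of permutations of `ℤ` generated by
`s_0, …, s_{n-1}`. -/
def AffineWeyl (n : ℕ) [Fact (1 < n)] : Subgroup (Equiv.Perm ℤ) :=
  Subgroup.closure (Set.range (simpleRefl (n := n)))

/-- The element `s_{i_1} ⋯ s_{i_l}` for the word `[i_1, …, i_l]`. -/
def wordProd {n : ℕ} [Fact (1 < n)] (u : List (ZMod n)) : AffineWeyl n :=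
  (u.map fun i => (⟨simpleRefl i, Subgroup.subset_closure ⟨i, rfl⟩⟩ : AffineWeyl n)).prod

/-- `u` is a reduced word of `w`. -/
def IsReducedWord {n : ℕ} [Fact (1 < n)] (u : List (ZMod n)) (w : AffineWeyl n) : Prop :=
  wordProd u = w ∧ ∀ v : List (ZMod n), wordProd v = w → u.length ≤ v.length

theorem exists_wordProd {n : ℕ} [Fact (1 < n)] (w : AffineWeyl n) :
    ∃ u : List (ZMod n), wordProd u = w := by
  obtain ⟨w, hw⟩ := w
  induction hw using Subgroup.closure_induction with
  | mem x hx =>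
    obtain ⟨i, rfl⟩ := hx
    exact ⟨[i], by simp [wordProd]⟩
  | one => exact ⟨[], rfl⟩
  | mul x y hx hy ihx ihy =>
    obtain ⟨u, hu⟩ := ihx
    obtain ⟨v, hv⟩ := ihy
    refine ⟨u ++ v, ?_⟩
    have : wordProd (u ++ v) = wordProd u * wordProd v := by simp [wordProd]
    rw [this, hu, hv]
    rfl
  | inv x hx ih =>
    obtain ⟨u, hu⟩ := ih
    refine ⟨u.reverse, ?_⟩
    have : wordProd u.reverse = (wordProd u)⁻¹ := by
      simp only [wordProd, List.prod_inv_reverse, List.map_reverse, List.map_map]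
      congr 2
    rw [this, hu]
    rfl

theorem exists_isReducedWord {n : ℕ} [Fact (1 < n)] (w : AffineWeyl n) :
    ∃ u : List (ZMod n), IsReducedWord u w := by
  classical
  have h : ∃ l, ∃ u : List (ZMod n), u.length = l ∧ wordProd u = w :=
    (exists_wordProd w).elim fun u hu => ⟨_, u, rfl, hu⟩
  obtain ⟨u, hl, hu⟩ := Nat.find_spec h
  exact ⟨u, hu, fun v hv => hl ▸ Nat.find_min' h ⟨v, rfl, hv⟩⟩

/-- `D_w = D_{i_1} ⋯ D_{i_l}` for a reduced word `s_{i_1} ⋯ s_{i_l}` of `w`. -/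
def demazureElt {n : ℕ} [Fact (1 < n)] (w : AffineWeyl n) (f : SymSeries n) : SymSeries n :=
  (exists_isReducedWord w).choose.foldr demazure f

/-- The closed `K`-theoretic double `k`-Schur function `g̃_w^{(k)}(y|b) = D_w(1)`, `k = n - 1`. -/
def closedKSchur {n : ℕ} [Fact (1 < n)] (w : AffineWeyl n) : SymSeries n := demazureElt w 1

/-! ### `k`-bounded partitions, `k = n - 1` -/

/-- A `k`-bounded partition for `k = n - 1`: the multiset of its (positive) parts, all at most
`n - 1`. -/
structure BoundedPartition (n : ℕ) where
  parts : Multiset ℕ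
  pos : ∀ p ∈ parts, 0 < p
  lt : ∀ p ∈ parts, p < n

/-- `λ ∪ μ`: the partition whose parts are those of `λ` together with those of `μ`. -/
def BoundedPartition.union {n : ℕ} (lam mu : BoundedPartition n) : BoundedPartition n where
  parts := lam.parts + mu.parts
  pos := fun p hp => (Multiset.mem_add.1 hp).elim (lam.pos p) (mu.pos p)
  lt := fun p hp => (Multiset.mem_add.1 hp).elim (lam.lt p) (mu.lt p)

/-- The `k`-rectangle `R_i = (i)^{n-i}`. -/
def rectangle {n i : ℕ} (h0 : 1 ≤ i) (hn : i ≤ n - 1) : BoundedPartition n where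
  parts := Multiset.replicate (n - i) i
  pos := fun p hp => by rw [Multiset.eq_of_mem_replicate hp]; omega
  lt := fun p hp => by rw [Multiset.eq_of_mem_replicate hp]; omega

/-- The residues (column minus row, modulo `n`) of the boxes of the rows `ps`, the first of which is
row number `r` (rows and columns counted from `0`), read from the bottom row to the top row and from
right to left in each row. -/
def residueWord (n : ℕ) : ℕ → List ℕ → List (ZMod n)
  | _, [] => []
  | r, p :: ps => residueWord n (r + 1) ps ++ (List.range p).reverse.map fun c => (c : ZMod n) - r

/-- The affine Grassmannian element corresponding to a `k`-bounded partition. -/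
def BoundedPartition.toAffineWeyl {n : ℕ} [Fact (1 < n)] (lam : BoundedPartition n) :
    AffineWeyl n :=
  wordProd (residueWord n 0 (lam.parts.sort (· ≥ ·)))

/-- `g̃_λ^{(k)}(y|b)` for a `k`-bounded partition `λ`, `k = n - 1`. -/
def gTilde {n : ℕ} [Fact (1 < n)] (lam : BoundedPartition n) : SymSeries n :=
  closedKSchur lam.toAffineWeyl

end KSchur
end

noncomputable section

namespace KSchur

/-! ### Level zero Demazure operators and their braid relations. -/

section Algebra

variable {n : ℕ}

/-! Write `g` for the series of `R_i` and `ω` for the cyclic shift of the parameters. The heart is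
the identity `D_{j+i}(ω^i f · g) = ω^i(D_j f) · g` for all `j` and `f` (`demazure_cyc_pow_mul`).
Starting at `f = 1` and adding the letters of the word of `λ` one at a time, it turns the operators
of that word, with all letters raised by `i` and applied to `g`, into `ω^i g̃_λ · g`. It remains to
see that the raised word of `λ` followed by the word of `R_i` is a reduced word of `w_{λ ∪ R_i}`.

For the identity, multiplication by `Ω(b_1)⋯Ω(b_c)` conjugates every `D_j` with `j ≠ c` into the
untwisted operator (`demazure_omegaProd_mul`). The series `g` is fixed by all `D_j` with `j ≠ i`
(`demazure_gTilde_rectangle`), so `g = Ω(b_1)⋯Ω(b_i) G` with `G` symmetric in the `a_j`. Multiplying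
by `g` therefore moves the twist from the index `0` to the index `i`, which is what `ω^i` does. The
same conjugation reduces the braid relations for the `D_j` to the untwisted case.

For the words, `w_{R_i}` acts on `ℤ` as the shift by `i`, except that the classes of `1, …, i` are
also lowered by `n` (`rectangleWord_apply`). Hence it passes through rows of length at least `i` by
raising their residues by `i`, while shorter rows are raised by `i` when pushed below the rectangle
(`wordProd_union_rectangle`). Independence of the reduced word (`foldr_demazure_eq`) comes from the
braid relations, with length measured by affine inversions. -/

theorem permWeight_mul (p q : Equiv.Perm (ZMod n)) (μ : WeightLattice n) :
    permWeight (p * q) μ = permWeight p (permWeight q μ) := by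
  induction μ using QuotientAddGroup.induction_on with
  | H v => rfl

theorem permRep_mul (p q : Equiv.Perm (ZMod n)) (r : RepRing n) :
    permRep (p * q) r = permRep p (permRep q r) := by
  induction r using AddMonoidAlgebra.induction_linear with
  | zero => simp
  | add f g hf hg => rw [map_add, map_add, map_add, hf, hg]
  | single μ c => simp [permRep, permWeight_mul]

theorem permRep_one (r : RepRing n) : permRep 1 r = r := by
  induction r using AddMonoidAlgebra.induction_linear with
  | zero => simp
  | add f g hf hg => rw [map_add, hf, hg]
  | single μ c =>
    induction μ using QuotientAddGroup.induction_on with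
    | H v => simp only [permRep, AddMonoidAlgebra.mapDomainRingHom_apply,
        AddMonoidAlgebra.mapDomain_single]; rfl

theorem permSeries_sub (p : Equiv.Perm (ZMod n)) (f g : SymSeries n) :
    permSeries p (f - g) = permSeries p f - permSeries p g := by
  apply Subtype.ext
  change MvPowerSeries.map (permRep p) (f.1 - g.1) =
    MvPowerSeries.map (permRep p) f.1 - MvPowerSeries.map (permRep p) g.1
  exact map_sub _ _ _

theorem coeff_permSeries (p : Equiv.Perm (ZMod n)) (f : SymSeries n) (m : ℕ →₀ ℕ) :
    MvPowerSeries.coeff m (permSeries p f).1 = permRep p (MvPowerSeries.coeff m f.1) := by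
  simp [permSeries]

theorem SymSeries.ext_coeff {f g : SymSeries n}
    (h : ∀ m, MvPowerSeries.coeff m f.1 = MvPowerSeries.coeff m g.1) : f = g :=
  Subtype.ext (MvPowerSeries.ext h)

theorem permSeries_mul (p q : Equiv.Perm (ZMod n)) (f : SymSeries n) :
    permSeries (p * q) f = permSeries p (permSeries q f) :=
  SymSeries.ext_coeff fun m => by simp only [coeff_permSeries, permRep_mul]

theorem permSeries_one (f : SymSeries n) : permSeries 1 f = f :=
  SymSeries.ext_coeff fun m => by simp only [coeff_permSeries, permRep_one]

theorem permRep_bParam (p : Equiv.Perm (ZMod n)) (j : ZMod n) :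
    permRep p (bParam n j) = bParam n (p j) := by
  simp only [bParam, map_sub, map_one, permRep_expWt, map_neg, permWeight_weight]

theorem permSeries_Omega (p : Equiv.Perm (ZMod n)) (j : ZMod n) :
    permSeries p (Omega n j) = Omega n (p j) :=
  SymSeries.ext_coeff fun m => by
    rw [coeff_permSeries]
    change permRep p (bParam n j ^ m.degree) = bParam n (p j) ^ m.degree
    rw [map_pow, permRep_bParam]

/-- The constant series `e^μ`. -/
def expSeries (μ : WeightLattice n) : SymSeries n := algebraMap (RepRing n) (SymSeries n) (expWt μ)

theorem permSeries_expSeries (p : Equiv.Perm (ZMod n)) (μ : WeightLattice n) :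
    permSeries p (expSeries μ) = expSeries (permWeight p μ) :=
  SymSeries.ext_coeff fun m => by
    classical
    rw [coeff_permSeries]
    change permRep p (MvPowerSeries.coeff m (MvPowerSeries.C (expWt μ))) =
      MvPowerSeries.coeff m (MvPowerSeries.C (expWt (permWeight p μ)))
    rw [MvPowerSeries.coeff_C, MvPowerSeries.coeff_C]
    split_ifs
    · rw [permRep_expWt]
    · rw [map_zero]

theorem expSeries_add (μ ν : WeightLattice n) :
    expSeries (μ + ν) = expSeries μ * expSeries ν := by
  rw [expSeries, expWt_add, map_mul]; rfl

theorem expSeries_zero : expSeries (0 : WeightLattice n) = 1 := by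
  rw [expSeries, expWt_zero, map_one]

theorem one_sub_expWt_smul (μ : WeightLattice n) (f : SymSeries n) :
    (1 - expWt μ) • f = (1 - expSeries μ) * f := by
  rw [Algebra.smul_def, map_sub, map_one]; rfl

/-- The simple reflection at `i` acting on the coefficients only. -/
abbrev coeffRefl (i : ZMod n) : SymSeries n →+* SymSeries n := permSeries (Equiv.swap i (i + 1))

/-- The constant series `e^{α_i}`. -/
abbrev rootExp (n : ℕ) (i : ZMod n) : SymSeries n := expSeries (root n i)

theorem permSeries_rootExp_cyc (i j : ZMod n) (p : Equiv.Perm (ZMod n)) (h : p j = i)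
    (h' : p (j + 1) = i + 1) : permSeries p (rootExp n j) = rootExp n i := by
  rw [rootExp, permSeries_expSeries, root, map_sub, permWeight_weight, permWeight_weight, h, h']
  rfl

theorem coeffRefl_coeffRefl (i : ZMod n) (f : SymSeries n) :
    coeffRefl i (coeffRefl i f) = f := by
  rw [coeffRefl, ← permSeries_mul, Equiv.swap_mul_self, permSeries_one]

theorem rootExp_mul_coeffRefl (i : ZMod n) :
    rootExp n i * coeffRefl i (rootExp n i) = 1 := by
  rw [coeffRefl, rootExp, permSeries_expSeries, ← expSeries_add, root, map_sub, permWeight_weight,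
    permWeight_weight, Equiv.swap_apply_left, Equiv.swap_apply_right, sub_add_sub_cancel,
    sub_self, expSeries_zero]

variable [Fact (1 < n)]

/-- The operators are defined by choosing a quotient, so identities between them are all checked
after clearing denominators and cancelled with this. -/
theorem one_sub_rootExp_mul_cancel (i : ZMod n) {f g : SymSeries n}
    (h : (1 - rootExp n i) * f = (1 - rootExp n i) * g) : f = g :=
  smul_root_injective n i (by
    change (1 - expWt _) • f = (1 - expWt _) • g
    rw [one_sub_expWt_smul, one_sub_expWt_smul]; exact h)

theorem one_sub_rootExp_mul_demazure (i : ZMod n) (f : SymSeries n) :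
    (1 - rootExp n i) * demazure i f = simpleAct n i f - rootExp n i * f := by
  have h := demazureT_spec i f
  rw [one_sub_expWt_smul] at h
  rw [demazure, mul_add, h]; ring

/-- The level zero Demazure operator. -/
def demazureZero (i : ZMod n) (f : SymSeries n) : SymSeries n :=
  (exists_smul_permSeries_sub i f).choose + f

theorem one_sub_rootExp_mul_demazureZero (i : ZMod n) (f : SymSeries n) :
    (1 - rootExp n i) * demazureZero i f = coeffRefl i f - rootExp n i * f := by
  have h := (exists_smul_permSeries_sub i f).choose_spec
  rw [one_sub_expWt_smul] at h
  rw [demazureZero, mul_add, h]; ring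

/-- Since `s_i` inverts `e^{α_i}`, it changes numerator and denominator of `(s_i f - e^{α_i} f) / (1
- e^{α_i})` by the same factor. -/
theorem coeffRefl_demazureZero (i : ZMod n) (f : SymSeries n) :
    coeffRefl i (demazureZero i f) = demazureZero i f := by
  apply one_sub_rootExp_mul_cancel i
  have h := one_sub_rootExp_mul_demazureZero i f
  have h2 := congrArg (coeffRefl i) h
  rw [map_mul, permSeries_sub, permSeries_sub, map_mul, map_one, coeffRefl_coeffRefl] at h2
  have h3 := rootExp_mul_coeffRefl i
  linear_combination (-1 : SymSeries n) * h - rootExp n i * h2 +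
    (coeffRefl i f - coeffRefl i (demazureZero i f)) * h3

theorem demazureZero_eq_of_coeffRefl (i : ZMod n) {f : SymSeries n} (h : coeffRefl i f = f) :
    demazureZero i f = f := by
  apply one_sub_rootExp_mul_cancel i
  rw [one_sub_rootExp_mul_demazureZero, h]; ring

theorem coeffRefl_rootExp_succ {i : ZMod n} (h1 : i + 1 + 1 ≠ i) :
    coeffRefl i (rootExp n (i + 1)) = rootExp n i * rootExp n (i + 1) := by
  have h0 : i + 1 + 1 ≠ i + 1 := by simp
  rw [coeffRefl, rootExp, permSeries_expSeries, ← expSeries_add, root, map_sub, permWeight_weight,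
    permWeight_weight, Equiv.swap_apply_right, Equiv.swap_apply_of_ne_of_ne h1 h0, root,
    sub_add_sub_cancel]

theorem coeffRefl_succ_rootExp {i : ZMod n} (h1 : i + 1 + 1 ≠ i) :
    coeffRefl (i + 1) (rootExp n i) = rootExp n i * rootExp n (i + 1) := by
  have h0 : i ≠ i + 1 := by simp
  rw [coeffRefl, rootExp, permSeries_expSeries, ← expSeries_add, root, map_sub, permWeight_weight,
    permWeight_weight, Equiv.swap_apply_left, Equiv.swap_apply_of_ne_of_ne h0 h1.symm, root,
    sub_add_sub_cancel]

theorem swap_braid {i : ZMod n} (h1 : i + 1 + 1 ≠ i) :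
    Equiv.swap i (i + 1) * Equiv.swap (i + 1) (i + 1 + 1) * Equiv.swap i (i + 1) =
      Equiv.swap (i + 1) (i + 1 + 1) * Equiv.swap i (i + 1) * Equiv.swap (i + 1) (i + 1 + 1) := by
  have h0 : i + 1 + 1 ≠ i + 1 := by simp
  have h2 : i ≠ i + 1 := by simp
  have e1 := Equiv.swap_mul_swap_mul_swap (x := i + 1 + 1) (y := i + 1) (z := i) h0 h1
  have e2 := Equiv.swap_mul_swap_mul_swap (x := i) (y := i + 1) (z := i + 1 + 1) h2 h1.symm
  rw [Equiv.swap_comm (i + 1) i, Equiv.swap_comm (i + 1 + 1) (i + 1)] at e1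
  rw [e1, e2, Equiv.swap_comm]

theorem coeffRefl_braid {i : ZMod n} (h1 : i + 1 + 1 ≠ i) (f : SymSeries n) :
    coeffRefl i (coeffRefl (i + 1) (coeffRefl i f)) =
      coeffRefl (i + 1) (coeffRefl i (coeffRefl (i + 1) f)) := by
  simp only [coeffRefl, ← permSeries_mul, ← mul_assoc, swap_braid h1]

theorem demazureZero_braid {i : ZMod n} (h1 : i + 1 + 1 ≠ i) (f : SymSeries n) :
    demazureZero i (demazureZero (i + 1) (demazureZero i f)) =
      demazureZero (i + 1) (demazureZero i (demazureZero (i + 1) f)) := by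
  -- Multiplying by the factors of all three positive roots of `A_2` leaves an expression symmetric
  -- in `j` and `k` except for its leading term, which is handled by the braid relation for
  -- transpositions.
  have key : ∀ {j k : ZMod n}, coeffRefl j (rootExp n k) = rootExp n j * rootExp n k →
      coeffRefl k (rootExp n j) = rootExp n j * rootExp n k →
      (1 - rootExp n j) * ((1 - rootExp n k) * ((1 - rootExp n j * rootExp n k) *
        demazureZero j (demazureZero k (demazureZero j f)))) =
      coeffRefl j (coeffRefl k (coeffRefl j f)) - rootExp n k * coeffRefl j (coeffRefl k f) -
        rootExp n j * coeffRefl k (coeffRefl j f) +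
        rootExp n j ^ 2 * rootExp n k * coeffRefl k f +
        rootExp n j * rootExp n k ^ 2 * coeffRefl j f -
        rootExp n j ^ 2 * rootExp n k ^ 2 * f := by
    intro j k hjk hkj
    have hA := one_sub_rootExp_mul_demazureZero j f
    have sA := coeffRefl_demazureZero j f
    set A := demazureZero j f
    have hB := one_sub_rootExp_mul_demazureZero k A
    set B := demazureZero k A
    have hC := one_sub_rootExp_mul_demazureZero j B
    set C := demazureZero j B
    have hB' := congrArg (coeffRefl j) hB
    simp only [map_mul, permSeries_sub, map_one, hjk, sA] at hB'
    have hA' := congrArg (coeffRefl k) hA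
    simp only [map_mul, permSeries_sub, map_one, hkj] at hA'
    have hA'' := congrArg (coeffRefl j) hA'
    have hX := rootExp_mul_coeffRefl j
    simp only [map_mul, permSeries_sub, map_one, hjk] at hA''
    have e : coeffRefl j (rootExp n j) * (rootExp n j * rootExp n k) = rootExp n k := by
      linear_combination rootExp n k * hX
    rw [e] at hA''
    linear_combination (1 - rootExp n k) * (1 - rootExp n j * rootExp n k) * hC +
      (1 - rootExp n k) * hB' - rootExp n j * (1 - rootExp n j * rootExp n k) * hB + hA'' -
      rootExp n j * hA' + rootExp n j * rootExp n k ^ 2 * hA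
  have e1 := key (coeffRefl_rootExp_succ h1) (coeffRefl_succ_rootExp h1)
  have e2 := key (j := i + 1) (k := i) (by rw [coeffRefl_succ_rootExp h1, mul_comm])
    (by rw [coeffRefl_rootExp_succ h1, mul_comm])
  -- The non-simple root factor is cancellable because `s_i` carries it to a simple one.
  have hc : ∀ {g h : SymSeries n}, (1 - rootExp n i * rootExp n (i + 1)) * g =
      (1 - rootExp n i * rootExp n (i + 1)) * h → g = h := by
    intro g h hgh
    have h2 := congrArg (coeffRefl i) hgh
    simp only [map_mul, permSeries_sub, map_one, coeffRefl_rootExp_succ h1] at h2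
    have e : coeffRefl i (rootExp n i) * (rootExp n i * rootExp n (i + 1)) = rootExp n (i + 1) := by
      linear_combination rootExp n (i + 1) * rootExp_mul_coeffRefl i
    rw [e] at h2
    have := congrArg (coeffRefl i) (one_sub_rootExp_mul_cancel _ h2)
    rwa [coeffRefl_coeffRefl, coeffRefl_coeffRefl] at this
  apply hc
  apply one_sub_rootExp_mul_cancel (i + 1)
  apply one_sub_rootExp_mul_cancel i
  linear_combination e1 - e2 + coeffRefl_braid h1 f

theorem demazureZero_comm {i j : ZMod n} (h0 : i ≠ j) (h1 : i + 1 ≠ j) (h2 : j + 1 ≠ i)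
    (f : SymSeries n) :
    demazureZero i (demazureZero j f) = demazureZero j (demazureZero i f) := by
  have h3 : i + 1 ≠ j + 1 := fun h => h0 (add_right_cancel h)
  have hij : coeffRefl i (rootExp n j) = rootExp n j := permSeries_rootExp_cyc _ _ _
    (Equiv.swap_apply_of_ne_of_ne h0.symm h1.symm) (Equiv.swap_apply_of_ne_of_ne h2 h3.symm)
  have hji : coeffRefl j (rootExp n i) = rootExp n i := permSeries_rootExp_cyc _ _ _
    (Equiv.swap_apply_of_ne_of_ne h0 h2.symm) (Equiv.swap_apply_of_ne_of_ne h1 h3)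
  have hs : coeffRefl i (coeffRefl j f) = coeffRefl j (coeffRefl i f) := by
    simp only [coeffRefl, ← permSeries_mul]
    congr 1
    have : Equiv.swap i (i + 1) * Equiv.swap j (j + 1) * (Equiv.swap i (i + 1))⁻¹ =
        Equiv.swap j (j + 1) := by
      rw [← Equiv.swap_apply_apply, Equiv.swap_apply_of_ne_of_ne h0.symm h1.symm,
        Equiv.swap_apply_of_ne_of_ne h2 h3.symm]
    exact congrArg _ (mul_inv_eq_iff_eq_mul.1 this)
  apply one_sub_rootExp_mul_cancel i
  apply one_sub_rootExp_mul_cancel j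
  have a1 := one_sub_rootExp_mul_demazureZero i (demazureZero j f)
  have a2 := one_sub_rootExp_mul_demazureZero j f
  have a3 := congrArg (coeffRefl i) a2
  have b1 := one_sub_rootExp_mul_demazureZero j (demazureZero i f)
  have b2 := one_sub_rootExp_mul_demazureZero i f
  have b3 := congrArg (coeffRefl j) b2
  simp only [map_mul, permSeries_sub, map_one, hij, hji] at a3 b3
  linear_combination (1 - rootExp n j) * a1 + a3 - rootExp n i * a2 - (1 - rootExp n i) * b1 - b3 +
    rootExp n j * b2 + hs

end Algebra

/-! ### Removing the twist of `s_0` by products of `Ω`. -/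

section Twist

variable {n : ℕ}

instance neZero_of_fact_one_lt [h : Fact (1 < n)] : NeZero n := ⟨by have := h.out; omega⟩

/-- The product of the series `Ω(b_j|y)` over a set of indices. -/
def omegaProd (S : Finset (ZMod n)) : SymSeries n := ∏ j ∈ S, Omega n j

theorem isUnit_omegaProd (S : Finset (ZMod n)) : IsUnit (omegaProd S) := by
  classical
  induction S using Finset.induction_on with
  | empty => simp [omegaProd]
  | insert a S ha ih =>
    rw [omegaProd, Finset.prod_insert ha]
    exact (isUnit_Omega n a).mul ih

theorem permSeries_omegaProd_of_mem_iff (p : Equiv.Perm (ZMod n)) {S : Finset (ZMod n)}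
    (h : ∀ j, p j ∈ S ↔ j ∈ S) : permSeries p (omegaProd S) = omegaProd S := by
  rw [omegaProd, map_prod]
  simp only [permSeries_Omega]
  exact Finset.prod_bijective p p.bijective (fun j => (h j).symm) fun j _ => rfl

theorem permSeries_swap_omegaProd {S : Finset (ZMod n)} {a b : ZMod n} (h : a ∈ S ↔ b ∈ S) :
    permSeries (Equiv.swap a b) (omegaProd S) = omegaProd S := by
  refine permSeries_omegaProd_of_mem_iff _ fun j => ?_
  by_cases ha : j = a
  · rw [ha, Equiv.swap_apply_left, h]
  · by_cases hb : j = b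
    · rw [hb, Equiv.swap_apply_right, h]
    · rw [Equiv.swap_apply_of_ne_of_ne ha hb]

/-- The transposition only replaces the factor at `a` by the one at `b`; cross-multiplying avoids
inverses. -/
theorem permSeries_swap_omegaProd_mul {S : Finset (ZMod n)} {a b : ZMod n} (ha : a ∈ S)
    (hb : b ∉ S) : permSeries (Equiv.swap a b) (omegaProd S) * Omega n a =
      omegaProd S * Omega n b := by
  have e : omegaProd S = Omega n a * omegaProd (S.erase a) := (Finset.mul_prod_erase S _ ha).symm
  have h : permSeries (Equiv.swap a b) (omegaProd (S.erase a)) = omegaProd (S.erase a) :=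
    permSeries_swap_omegaProd (by simp [hb])
  rw [e, map_mul, h, permSeries_Omega, Equiv.swap_apply_left]
  ring

theorem Omega_zero_mul_inverse : Omega n 0 * Ring.inverse (Omega n 0) = 1 :=
  Ring.mul_inverse_cancel _ (isUnit_Omega n 0)

theorem cyc_pow_apply (c : ℕ) (j : ZMod n) : (cyc n ^ c) j = j + c := by
  induction c with
  | zero => simp
  | succ c ih =>
    rw [pow_succ', Equiv.Perm.mul_apply, ih]
    simp [cyc, add_assoc]

theorem permSeries_cyc_pow_coeffRefl (c : ℕ) (j : ZMod n) (f : SymSeries n) :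
    permSeries (cyc n ^ c) (coeffRefl j f) =
      coeffRefl (j + (c : ZMod n)) (permSeries (cyc n ^ c) f) := by
  rw [coeffRefl, coeffRefl, ← permSeries_mul, ← permSeries_mul]
  congr 1
  rw [Equiv.mul_swap_eq_swap_mul, cyc_pow_apply, cyc_pow_apply, add_right_comm]

theorem permSeries_cyc_pow_rootExp (c : ℕ) (j : ZMod n) :
    permSeries (cyc n ^ c) (rootExp n j) = rootExp n (j + (c : ZMod n)) :=
  permSeries_rootExp_cyc _ _ _ (cyc_pow_apply c j) (by rw [cyc_pow_apply, add_right_comm])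

variable [Fact (1 < n)]

theorem val_add_one_eq (j : ZMod n) :
    (j + 1).val = if j.val + 1 = n then 0 else j.val + 1 := by
  have := Fact.out (p := 1 < n)
  have h1 : (1 : ZMod n).val = 1 := ZMod.val_one n
  rw [ZMod.val_add, h1]
  split_ifs with h
  · rw [h, Nat.mod_self]
  · exact Nat.mod_eq_of_lt (by have := j.val_lt; omega)

/-- The indices `1, …, c`. -/
def initialIndices (n c : ℕ) [Fact (1 < n)] : Finset (ZMod n) :=
  Finset.univ.filter fun j => 1 ≤ j.val ∧ j.val ≤ c

theorem mem_initialIndices {c : ℕ} {j : ZMod n} :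
    j ∈ initialIndices n c ↔ 1 ≤ j.val ∧ j.val ≤ c := by
  simp [initialIndices]

/-- For `j ≠ 0` the set `{1, …, c}` contains both or neither of `j, j + 1`, so the product is
invariant. For `j = 0` it contains `1` but not `n`, and the resulting ratio `Ω(b_n) / Ω(b_1)`
cancels the twist. -/
theorem simpleAct_omegaProd_mul {c : ℕ} (hc : c < n) {j : ZMod n} (hj : j ≠ c) (f : SymSeries n) :
    simpleAct n j (omegaProd (initialIndices n c) * f) =
      omegaProd (initialIndices n c) * coeffRefl j f := by
  have hjc : j.val ≠ c := fun h => hj (by rw [← h, ZMod.natCast_zmod_val])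
  rw [simpleAct]
  split_ifs with h0
  · subst h0
    have h1 : (1 : ZMod n).val = 1 := ZMod.val_one n
    rw [ZMod.val_zero] at hjc
    have h := permSeries_swap_omegaProd_mul (S := initialIndices n c) (a := 1) (b := 0)
      (by rw [mem_initialIndices, h1]; omega) (by rw [mem_initialIndices, ZMod.val_zero]; omega)
    rw [Equiv.swap_comm] at h
    rw [map_mul, coeffRefl, zero_add]
    linear_combination (Ring.inverse (Omega n 0) * permSeries (Equiv.swap 0 1) f) * h +
      omegaProd (initialIndices n c) * permSeries (Equiv.swap 0 1) f * Omega_zero_mul_inverse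
  · rw [map_mul, permSeries_swap_omegaProd]
    rw [mem_initialIndices, mem_initialIndices, val_add_one_eq]
    have h1 : j.val ≠ 0 := by rwa [Ne, ZMod.val_eq_zero]
    have := j.val_lt
    split_ifs <;> omega

theorem demazure_omegaProd_mul {c : ℕ} (hc : c < n) {j : ZMod n} (hj : j ≠ c) (f : SymSeries n) :
    demazure j (omegaProd (initialIndices n c) * f) =
      omegaProd (initialIndices n c) * demazureZero j f := by
  apply one_sub_rootExp_mul_cancel j
  rw [one_sub_rootExp_mul_demazure, simpleAct_omegaProd_mul hc hj]
  linear_combination -omegaProd (initialIndices n c) * one_sub_rootExp_mul_demazureZero j f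

theorem exists_eq_omegaProd_mul (c : ℕ) (f : SymSeries n) :
    ∃ g, f = omegaProd (initialIndices n c) * g :=
  (isUnit_omegaProd _).dvd

theorem demazure_eq_of_simpleAct {j : ZMod n} {f : SymSeries n} (h : simpleAct n j f = f) :
    demazure j f = f := by
  apply one_sub_rootExp_mul_cancel j
  rw [one_sub_rootExp_mul_demazure, h]; ring

theorem demazure_one {j : ZMod n} (hj : j ≠ 0) : demazure j (1 : SymSeries n) = 1 :=
  demazure_eq_of_simpleAct (by rw [simpleAct, if_neg hj, map_one])

theorem demazure_demazure (j : ZMod n) (f : SymSeries n) :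
    demazure j (demazure j f) = demazure j f := by
  -- Any index other than `j` would serve for the conjugation.
  have hj : j ≠ ((j + 1).val : ℕ) := by rw [ZMod.natCast_zmod_val]; simp
  have hc := (j + 1).val_lt
  obtain ⟨g, rfl⟩ := exists_eq_omegaProd_mul (j + 1).val f
  rw [demazure_omegaProd_mul hc hj, demazure_omegaProd_mul hc hj,
    demazureZero_eq_of_coeffRefl j (coeffRefl_demazureZero j g)]

theorem exists_ne_ne (h : 2 < n) (i j : ZMod n) : ∃ c : ℕ, c < n ∧ i ≠ c ∧ j ≠ c := by
  obtain ⟨c, hc⟩ : ∃ c : ZMod n, c ∉ ({i, j} : Finset (ZMod n)) := by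
    by_contra! hcon
    have h1 : Finset.univ ⊆ ({i, j} : Finset (ZMod n)) := fun c _ => hcon c
    have h2 := Finset.card_le_card h1
    rw [Finset.card_univ, ZMod.card] at h2
    have := Finset.card_le_two (a := i) (b := j)
    omega
  simp only [Finset.mem_insert, Finset.mem_singleton, not_or] at hc
  refine ⟨c.val, c.val_lt, ?_, ?_⟩ <;> rw [ZMod.natCast_zmod_val]
  exacts [Ne.symm hc.1, Ne.symm hc.2]

theorem two_lt_of_ne {i : ZMod n} (h : i + 1 + 1 ≠ i) : 2 < n := by
  have := Fact.out (p := 1 < n)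
  by_contra hn
  obtain rfl : n = 2 := by omega
  exact h (by rw [add_assoc, show (1 : ZMod 2) + 1 = 0 from rfl, add_zero])

/-- Only two indices occur and `n > 2`, so a third index `c` is free and conjugates both operators
to level zero at once. -/
theorem demazure_braid {i : ZMod n} (h : i + 1 + 1 ≠ i) (f : SymSeries n) :
    demazure i (demazure (i + 1) (demazure i f)) =
      demazure (i + 1) (demazure i (demazure (i + 1) f)) := by
  obtain ⟨c, hc, h1, h2⟩ := exists_ne_ne (two_lt_of_ne h) i (i + 1)
  obtain ⟨g, rfl⟩ := exists_eq_omegaProd_mul c f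
  simp only [demazure_omegaProd_mul hc h1, demazure_omegaProd_mul hc h2]
  rw [demazureZero_braid h]

theorem demazure_comm {i j : ZMod n} (h0 : i ≠ j) (h1 : i + 1 ≠ j) (h2 : j + 1 ≠ i)
    (f : SymSeries n) : demazure i (demazure j f) = demazure j (demazure i f) := by
  have hn : 2 < n := by
    have := Fact.out (p := 1 < n)
    by_contra hn
    obtain rfl : n = 2 := by omega
    revert i j; decide
  obtain ⟨c, hc, h3, h4⟩ := exists_ne_ne hn i j
  obtain ⟨g, rfl⟩ := exists_eq_omegaProd_mul c f
  simp only [demazure_omegaProd_mul hc h3, demazure_omegaProd_mul hc h4]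
  rw [demazureZero_comm h0 h1 h2]

/-- A series fixed by all but one of the cyclically arranged simple transpositions is fixed by the
last one too. -/
theorem coeffRefl_eq_of_ne {c : ZMod n} {f : SymSeries n}
    (h : ∀ j, j ≠ c → coeffRefl j f = f) (j : ZMod n) : coeffRefl j f = f := by
  have hn := Fact.out (p := 1 < n)
  by_cases hj : j = c
  swap
  · exact h j hj
  subst hj
  -- Walk round the cycle from `j + 1` without using the missing transposition; after `n - 1` steps
  -- the endpoint is `j`.
  have key : ∀ k : ℕ, k < n → permSeries (Equiv.swap (j + 1) (j + 1 + (k : ZMod n))) f = f := by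
    intro k
    induction k with
    | zero => intro _; rw [Nat.cast_zero, add_zero, Equiv.swap_self]; exact permSeries_one f
    | succ k ih =>
      intro hk
      have hcast : ∀ m : ℕ, 0 < m → m < n → (m : ZMod n) ≠ 0 := fun m h0 h1 h2 => by
        rw [ZMod.natCast_eq_zero_iff] at h2
        exact absurd (Nat.le_of_dvd h0 h2) (by omega)
      have hb : j + 1 + (k : ZMod n) ≠ j := by
        intro e
        refine hcast (k + 1) (by omega) hk ?_
        push_cast
        linear_combination e
      have e1 := h _ hb
      rw [Nat.cast_succ, ← add_assoc]
      rcases Nat.eq_zero_or_pos k with rfl | hk0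
      · simpa [coeffRefl] using e1
      · have hab : j + 1 ≠ j + 1 + (k : ZMod n) := by
          simpa using hcast k hk0 (by omega)
        have hac : j + 1 ≠ j + 1 + (k : ZMod n) + 1 := by
          have := hcast (k + 1) (by omega) hk
          push_cast at this
          rw [add_assoc]
          simpa using this
        have e2 := Equiv.swap_mul_swap_mul_swap hab hac
        rw [Equiv.swap_comm, ← e2, permSeries_mul, permSeries_mul]
        rw [coeffRefl] at e1
        rw [e1, ih (by omega), e1]
  have := key (n - 1) (by omega)
  rw [Nat.cast_sub (by omega), Nat.cast_one, ZMod.natCast_self, zero_sub, add_neg_cancel_right,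
    Equiv.swap_comm] at this
  exact this

/-- Write `g = Ω(b_1)⋯Ω(b_c) G` with `G` invariant. At `j = c` the reflection produces `Ω(b_{c+1}) /
Ω(b_c)`, the `ω^c`-image of the twist in `s_0`; at every other `j` neither side keeps a twist. -/
theorem simpleAct_cyc_pow_mul {c : ℕ} (h0 : 1 ≤ c) (hc : c < n) {g : SymSeries n}
    (hg : ∀ j : ZMod n, j ≠ c → demazure j g = g) (j : ZMod n) (f : SymSeries n) :
    simpleAct n j (permSeries (cyc n ^ c) f * g) =
      permSeries (cyc n ^ c) (simpleAct n (j - c) f) * g := by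
  obtain ⟨G, rfl⟩ := exists_eq_omegaProd_mul c g
  -- For `j ≠ c`, `G` is fixed by the untwisted operator, whose image is `s_j`-invariant; the
  -- remaining transposition is generated by the others.
  have hG : ∀ j, coeffRefl j G = G := by
    refine coeffRefl_eq_of_ne (c := c) fun j hj => ?_
    have h1 := hg j hj
    rw [demazure_omegaProd_mul hc hj] at h1
    rw [← (isUnit_omegaProd _).mul_left_cancel h1, coeffRefl_demazureZero]
  by_cases hj : j = c
  · subst hj
    have hv : (c : ZMod n).val = c := ZMod.val_natCast_of_lt hc
    have hc0 : (c : ZMod n) ≠ 0 := by rw [Ne, ← ZMod.val_eq_zero, hv]; omega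
    have e1 := permSeries_swap_omegaProd_mul (S := initialIndices n c) (a := (c : ZMod n))
      (b := (c : ZMod n) + 1) (by rw [mem_initialIndices, hv]; omega) (by
        rw [mem_initialIndices, val_add_one_eq, hv]
        split_ifs <;> omega)
    have e2 := congrArg (permSeries (cyc n ^ c)) (Omega_zero_mul_inverse (n := n))
    rw [map_mul, map_one, permSeries_Omega, cyc_pow_apply, zero_add] at e2
    have e3 := permSeries_cyc_pow_coeffRefl c 0 f
    rw [coeffRefl, zero_add, zero_add] at e3
    have e4 := hG c
    rw [simpleAct, if_neg hc0, sub_self, simpleAct, if_pos rfl]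
    simp only [map_mul, permSeries_Omega, cyc_pow_apply]
    rw [e3, add_comm 1 (c : ZMod n)]
    rw [coeffRefl] at e4 ⊢
    rw [e4]
    linear_combination permSeries (Equiv.swap (c : ZMod n) (c + 1)) (permSeries (cyc n ^ c) f) *
      G * (permSeries (cyc n ^ c) (Ring.inverse (Omega n 0)) * e1 -
        permSeries (Equiv.swap (c : ZMod n) (c + 1)) (omegaProd (initialIndices n c)) * e2)
  · have hj' : j - c ≠ 0 := sub_ne_zero.2 hj
    rw [mul_left_comm, simpleAct_omegaProd_mul hc hj, map_mul, hG, simpleAct, if_neg hj']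
    have := permSeries_cyc_pow_coeffRefl c (j - (c : ZMod n)) f
    rw [sub_add_cancel] at this
    rw [this]
    ring

theorem demazure_cyc_pow_mul {c : ℕ} (h0 : 1 ≤ c) (hc : c < n) {g : SymSeries n}
    (hg : ∀ j : ZMod n, j ≠ c → demazure j g = g) (j : ZMod n) (f : SymSeries n) :
    demazure (j + (c : ZMod n)) (permSeries (cyc n ^ c) f * g) =
      permSeries (cyc n ^ c) (demazure j f) * g := by
  apply one_sub_rootExp_mul_cancel (j + (c : ZMod n))
  rw [one_sub_rootExp_mul_demazure, simpleAct_cyc_pow_mul h0 hc hg, add_sub_cancel_right]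
  have h := congrArg (permSeries (cyc n ^ c)) (one_sub_rootExp_mul_demazure j f)
  simp only [map_mul, permSeries_sub, map_one, permSeries_cyc_pow_rootExp] at h
  linear_combination -g * h

end Twist

/-! ### Length in the affine symmetric group by counting inversions. -/

section AffineLength

variable {n : ℕ}

theorem intCast_add_mul (x k : ℤ) : ((x + n * k : ℤ) : ZMod n) = x := by simp

theorem exists_eq_add_mul {x y : ℤ} (h : (x : ZMod n) = y) : ∃ k, x = y + n * k := by
  rw [ZMod.intCast_eq_intCast_iff_dvd_sub] at h
  obtain ⟨k, hk⟩ := h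
  exact ⟨-k, by linear_combination -hk⟩

theorem periodic_congr {M : Type*} {F : ℤ → M} (hF : ∀ x k, F (x + n * k) = F x) {x y : ℤ}
    (h : (x : ZMod n) = y) : F x = F y := by
  obtain ⟨k, rfl⟩ := exists_eq_add_mul h
  exact hF y k

variable [Fact (1 < n)]

theorem simpleRefl_of_eq {i : ZMod n} {x : ℤ} (h : (x : ZMod n) = i) :
    simpleRefl i x = x + 1 := if_pos h

theorem simpleRefl_of_eq_add_one {i : ZMod n} {x : ℤ} (h : (x : ZMod n) = i + 1) :
    simpleRefl i x = x - 1 :=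
  (if_neg (by rw [h]; simp)).trans (if_pos h)

theorem simpleRefl_of_ne {i : ZMod n} {x : ℤ} (h : (x : ZMod n) ≠ i) (h' : (x : ZMod n) ≠ i + 1) :
    simpleRefl i x = x :=
  (if_neg h).trans (if_neg h')

theorem simpleRefl_simpleRefl (i : ZMod n) (x : ℤ) : simpleRefl i (simpleRefl i x) = x :=
  Function.Involutive.toPerm_involutive _ x

theorem intCast_simpleRefl (i : ZMod n) (x : ℤ) :
    ((simpleRefl i x : ℤ) : ZMod n) = Equiv.swap i (i + 1) (x : ZMod n) := by
  by_cases h : (x : ZMod n) = i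
  · rw [simpleRefl_of_eq h, h, Equiv.swap_apply_left]; push_cast; rw [h]
  · by_cases h' : (x : ZMod n) = i + 1
    · rw [simpleRefl_of_eq_add_one h', h', Equiv.swap_apply_right]; push_cast; rw [h']; ring
    · rw [simpleRefl_of_ne h h', Equiv.swap_apply_of_ne_of_ne h h']

/-- The simple reflection as an element of the affine Weyl group. -/
def affineRefl (i : ZMod n) : AffineWeyl n := ⟨simpleRefl i, Subgroup.subset_closure ⟨i, rfl⟩⟩

theorem wordProd_cons (i : ZMod n) (u : List (ZMod n)) :
    wordProd (i :: u) = affineRefl i * wordProd u := rfl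

theorem wordProd_append (u v : List (ZMod n)) : wordProd (u ++ v) = wordProd u * wordProd v := by
  simp [wordProd]

theorem affineRefl_mul_self (i : ZMod n) : affineRefl i * affineRefl i = 1 :=
  Subtype.ext (Equiv.ext (simpleRefl_simpleRefl i))

theorem affineRefl_mul_cancel (i : ZMod n) (w : AffineWeyl n) :
    affineRefl i * (affineRefl i * w) = w := by
  rw [← mul_assoc, affineRefl_mul_self, one_mul]

theorem affineRefl_inv (i : ZMod n) : (affineRefl i)⁻¹ = affineRefl i :=
  inv_eq_of_mul_eq_one_left (affineRefl_mul_self i)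

theorem affineWeyl_add_mul (w : AffineWeyl n) (x k : ℤ) :
    w.1 (x + n * k) = w.1 x + n * k := by
  obtain ⟨u, rfl⟩ := exists_wordProd w
  induction u with
  | nil => rfl
  | cons i u ih =>
    rw [wordProd_cons]
    change simpleRefl i ((wordProd u).1 (x + n * k)) = simpleRefl i ((wordProd u).1 x) + n * k
    rw [ih]
    generalize (wordProd u).1 x = y
    by_cases h : (y : ZMod n) = i
    · rw [simpleRefl_of_eq h, simpleRefl_of_eq (by rw [intCast_add_mul, h])]; ring
    · by_cases h' : (y : ZMod n) = i + 1
      · rw [simpleRefl_of_eq_add_one h', simpleRefl_of_eq_add_one (by rw [intCast_add_mul, h'])]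
        ring
      · rw [simpleRefl_of_ne h h', simpleRefl_of_ne (by rwa [intCast_add_mul])
          (by rwa [intCast_add_mul])]

theorem inv_affineRefl_mul_apply (i : ZMod n) (w : AffineWeyl n) (x : ℤ) :
    (affineRefl i * w)⁻¹.1 x = w⁻¹.1 (simpleRefl i x) := by
  rw [mul_inv_rev, affineRefl_inv]; rfl

/-- A simple reflection permutes the residue classes modulo `n`, and a periodic function sees only
the class. -/
theorem sum_comp_simpleRefl {F : ℤ → ℤ} (hF : ∀ x k, F (x + n * k) = F x) (i : ZMod n) :
    ∑ r : ZMod n, F (simpleRefl i r.val) = ∑ r : ZMod n, F r.val := by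
  rw [← Equiv.sum_comp (Equiv.swap i (i + 1)) fun r : ZMod n => F r.val]
  refine Finset.sum_congr rfl fun r _ => periodic_congr hF ?_
  rw [intCast_simpleRefl]
  simp

/-- The number of inversions between the class of `x` and the class of `y` with the former
preceding the latter. -/
def classInversions (n : ℕ) (v : ℤ → ℤ) (x y : ℤ) : ℤ := max 0 ((y - x) / n - (v y - v x) / n)

/-- The number of inversions, modulo translation by `n`, of a map commuting with that
translation. -/
def inversionCount (n : ℕ) [Fact (1 < n)] (v : ℤ → ℤ) : ℤ :=
  ∑ r : ZMod n, ∑ s : ZMod n, classInversions n v r.val s.val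

theorem natCast_ne_zero_int : (n : ℤ) ≠ 0 := by
  have := Fact.out (p := 1 < n)
  omega

theorem add_mul_sub_ediv (a b k : ℤ) : (a + n * k - b) / n = (a - b) / n + k := by
  rw [add_sub_right_comm, Int.add_mul_ediv_left _ _ natCast_ne_zero_int]

theorem sub_add_mul_ediv (a b k : ℤ) : (a - (b + n * k)) / n = (a - b) / n - k := by
  have : a - (b + n * k) = a - b + n * (-k) := by ring
  rw [this, Int.add_mul_ediv_left _ _ natCast_ne_zero_int]; ring

theorem sub_one_ediv {d : ℤ} (h : (d : ZMod n) ≠ 0) : (d - 1) / n = d / n := by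
  have hn := Fact.out (p := 1 < n)
  have hpos : (0 : ℤ) < n := by omega
  have h1 := Int.emod_add_mul_ediv d n
  have h2 := Int.emod_nonneg d hpos.ne'
  have h3 := Int.emod_lt_of_pos d hpos
  have h4 : d % n ≠ 0 := fun h0 => h ((ZMod.intCast_zmod_eq_zero_iff_dvd d n).2
    (Int.dvd_of_emod_eq_zero h0))
  have : d - 1 = (d % n - 1) + n * (d / n) := by linear_combination -h1
  rw [this, Int.add_mul_ediv_left _ _ hpos.ne', Int.ediv_eq_zero_of_lt (by omega) (by omega),
    zero_add]

theorem add_one_ediv {d : ℤ} (h : (d : ZMod n) + 1 ≠ 0) : (d + 1) / n = d / n := by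
  have := sub_one_ediv (n := n) (d := d + 1) (by push_cast; exact h)
  rw [← this, add_sub_cancel_right]

/-- Floors of differences change only when the order of `x` and a translate of `y` changes, and
`s_i` reverses only pairs from the classes `i` and `i + 1`. -/
theorem simpleRefl_sub_ediv {i : ZMod n} {x y : ℤ}
    (h1 : ¬((x : ZMod n) = i ∧ (y : ZMod n) = i + 1))
    (h2 : ¬((x : ZMod n) = i + 1 ∧ (y : ZMod n) = i)) :
    (simpleRefl i y - simpleRefl i x) / (n : ℤ) = (y - x) / n := by
  have hne : i + 1 ≠ i := by simp
  by_cases hx : (x : ZMod n) = i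
  · by_cases hy : (y : ZMod n) = i
    · rw [simpleRefl_of_eq hx, simpleRefl_of_eq hy, add_sub_add_right_eq_sub]
    · have hy' : (y : ZMod n) ≠ i + 1 := fun h => h1 ⟨hx, h⟩
      rw [simpleRefl_of_eq hx, simpleRefl_of_ne hy hy', ← sub_sub, sub_one_ediv]
      push_cast; rwa [hx, sub_ne_zero]
  · by_cases hx' : (x : ZMod n) = i + 1
    · have hy : (y : ZMod n) ≠ i := fun h => h2 ⟨hx', h⟩
      by_cases hy' : (y : ZMod n) = i + 1
      · rw [simpleRefl_of_eq_add_one hx', simpleRefl_of_eq_add_one hy', sub_sub_sub_cancel_right]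
      · rw [simpleRefl_of_eq_add_one hx', simpleRefl_of_ne hy hy', sub_sub_eq_add_sub,
          add_sub_right_comm, add_one_ediv]
        push_cast; rw [hx']
        intro h
        exact hy (by linear_combination h)
    · rw [simpleRefl_of_ne hx hx']
      by_cases hy : (y : ZMod n) = i
      · rw [simpleRefl_of_eq hy, add_sub_right_comm, add_one_ediv]
        push_cast; rw [hy]
        intro h
        exact hx' (by linear_combination -h)
      · by_cases hy' : (y : ZMod n) = i + 1
        · rw [simpleRefl_of_eq_add_one hy', sub_right_comm, sub_one_ediv]
          push_cast; rw [hy', sub_ne_zero]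
          exact Ne.symm hx'
        · rw [simpleRefl_of_ne hy hy']

/-- Reindexing by `s_i` makes both counts involve the same values of `v`. They then differ only at
the ordered class pairs `(i, i + 1)` and `(i + 1, i)`, which contribute `0` and `1`. -/
theorem inversionCount_comp_simpleRefl {v : ℤ → ℤ} (hv : ∀ x k, v (x + n * k) = v x + n * k)
    {i : ZMod n} {x : ℤ} (hx : (x : ZMod n) = i) (h : v x < v (x + 1)) :
    inversionCount n (fun y => v (simpleRefl i y)) = inversionCount n v + 1 := by
  have hn := Fact.out (p := 1 < n)
  have hs : ∀ y k, simpleRefl i (y + n * k) = simpleRefl i y + n * k :=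
    affineWeyl_add_mul (affineRefl i)
  set G : ℤ → ℤ → ℤ := fun x y =>
    max 0 ((simpleRefl i y - simpleRefl i x) / n - (v y - v x) / n) with hG
  have e1 : inversionCount n (fun y => v (simpleRefl i y)) =
      ∑ r : ZMod n, ∑ s : ZMod n, G r.val s.val := by
    have per1 : ∀ y x k : ℤ, classInversions n (fun y => v (simpleRefl i y)) (x + n * k) y =
        classInversions n (fun y => v (simpleRefl i y)) x y := by
      intro y x k
      simp only [classInversions, hs, hv, sub_add_mul_ediv]
      congr 1; ring
    have per2 : ∀ x y k : ℤ, classInversions n (fun y => v (simpleRefl i y)) x (y + n * k) =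
        classInversions n (fun y => v (simpleRefl i y)) x y := by
      intro x y k
      simp only [classInversions, hs, hv, add_mul_sub_ediv]
      congr 1; ring
    rw [inversionCount]
    rw [← sum_comp_simpleRefl (F := fun x => ∑ s : ZMod n,
      classInversions n (fun y => v (simpleRefl i y)) x s.val) (fun x k => by simp only [per1]) i]
    refine Finset.sum_congr rfl fun r _ => ?_
    rw [← sum_comp_simpleRefl (F := fun y =>
      classInversions n (fun y => v (simpleRefl i y)) _ y) (fun y k => per2 _ _ _) i]
    refine Finset.sum_congr rfl fun s _ => ?_
    simp only [classInversions, simpleRefl_simpleRefl, hG]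
  set H : ℤ → ℤ → ℤ := fun x y => G x y - classInversions n v x y with hH
  have perH1 : ∀ y x k : ℤ, H (x + n * k) y = H x y := by
    intro y x k
    simp only [hH, hG, classInversions, hs, hv, sub_add_mul_ediv]
    congr 2 <;> ring
  have perH2 : ∀ x y k : ℤ, H x (y + n * k) = H x y := by
    intro x y k
    simp only [hH, hG, classInversions, hs, hv, add_mul_sub_ediv]
    congr 2 <;> ring
  have e2 : inversionCount n (fun y => v (simpleRefl i y)) - inversionCount n v =
      ∑ p : ZMod n × ZMod n, H p.1.val p.2.val := by
    rw [e1, inversionCount, Fintype.sum_prod_type]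
    simp only [hH, Finset.sum_sub_distrib]
  have hne : i + 1 ≠ i := by simp
  have e3 : ∑ p : ZMod n × ZMod n, H p.1.val p.2.val =
      ∑ p ∈ ({(i, i + 1), (i + 1, i)} : Finset (ZMod n × ZMod n)), H p.1.val p.2.val := by
    symm
    refine Finset.sum_subset (Finset.subset_univ _) fun p _ hp => ?_
    simp only [Finset.mem_insert, Finset.mem_singleton, Prod.ext_iff, not_or] at hp
    simp only [hH, hG, classInversions]
    rw [simpleRefl_sub_ediv (by simpa using hp.1) (by simpa using hp.2), sub_self]
  have hx1 : ((x + 1 : ℤ) : ZMod n) = i + 1 := by push_cast; rw [hx]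
  have e4 : ∀ {r s : ZMod n} {a b : ℤ}, (a : ZMod n) = r → (b : ZMod n) = s →
      H r.val s.val = H a b := by
    rintro r s a b rfl rfl
    exact (periodic_congr (F := fun x => H x _) (perH1 _) (by simp)).trans
      (periodic_congr (perH2 a) (by simp))
  rw [Finset.sum_pair (by simp [Prod.ext_iff]), e4 hx hx1, e4 hx1 hx] at e3
  have one_div : (1 : ℤ) / n = 0 := Int.ediv_eq_zero_of_lt (by omega) (by omega)
  have neg_one_div : (-1 : ℤ) / n = -1 := by
    rw [show (-1 : ℤ) = ((n : ℤ) - 1) + n * (-1) by ring,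
      Int.add_mul_ediv_left _ _ natCast_ne_zero_int,
      Int.ediv_eq_zero_of_lt (by omega) (by omega)]
    ring
  have hpos : (0 : ℤ) < n := by omega
  have h5 : 0 ≤ (v (x + 1) - v x) / (n : ℤ) := Int.ediv_nonneg (by omega) hpos.le
  have h6 : (v x - v (x + 1)) / (n : ℤ) < 0 := Int.ediv_neg_of_neg_of_pos (by omega) hpos
  have h7 : H x (x + 1) = 0 := by
    simp only [hH, hG, classInversions]
    rw [simpleRefl_of_eq hx, simpleRefl_of_eq_add_one hx1,
      show x + 1 - 1 - (x + 1) = -1 by ring, show x + 1 - x = 1 by ring, one_div, neg_one_div]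
    omega
  have h8 : H (x + 1) x = 1 := by
    simp only [hH, hG, classInversions]
    rw [simpleRefl_of_eq hx, simpleRefl_of_eq_add_one hx1,
      show x + 1 - (x + 1 - 1) = 1 by ring, show x - (x + 1) = -1 by ring, one_div, neg_one_div]
    omega
  omega

/-- The length of an element of the affine Weyl group, as an inversion count. -/
def affineLength (w : AffineWeyl n) : ℤ := inversionCount n w⁻¹.1

theorem affineLength_nonneg (w : AffineWeyl n) : 0 ≤ affineLength w :=
  Finset.sum_nonneg fun _ _ => Finset.sum_nonneg fun _ _ => le_max_left _ _

theorem affineLength_one : affineLength (1 : AffineWeyl n) = 0 :=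
  Finset.sum_eq_zero fun r _ => Finset.sum_eq_zero fun s _ => by simp [classInversions]

/-- Left multiplication by `s_i` precomposes `w⁻¹` with `s_i`; this is why length counts inversions
of the inverse. -/
theorem affineLength_affineRefl_mul_of_lt {w : AffineWeyl n} {i : ZMod n} {x : ℤ}
    (hx : (x : ZMod n) = i) (h : w⁻¹.1 x < w⁻¹.1 (x + 1)) :
    affineLength (affineRefl i * w) = affineLength w + 1 := by
  rw [affineLength, affineLength, ← inversionCount_comp_simpleRefl (affineWeyl_add_mul w⁻¹) hx h]
  simp only [← inv_affineRefl_mul_apply]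

theorem affineLength_affineRefl_mul_of_gt {w : AffineWeyl n} {i : ZMod n} {x : ℤ}
    (hx : (x : ZMod n) = i) (h : w⁻¹.1 (x + 1) < w⁻¹.1 x) :
    affineLength (affineRefl i * w) = affineLength w - 1 := by
  have h1 := affineLength_affineRefl_mul_of_lt (w := affineRefl i * w) hx (by
    rw [inv_affineRefl_mul_apply, inv_affineRefl_mul_apply, simpleRefl_of_eq hx,
      simpleRefl_of_eq_add_one (by push_cast; rw [hx]), add_sub_cancel_right]
    exact h)
  rw [affineRefl_mul_cancel] at h1
  omega

theorem affineWeyl_apply_ne (w : AffineWeyl n) (x : ℤ) : w.1 x ≠ w.1 (x + 1) := fun h => by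
  have := w.1.injective h
  omega

theorem affineLength_wordProd_le (u : List (ZMod n)) :
    affineLength (wordProd u) ≤ u.length := by
  induction u with
  | nil => exact affineLength_one.le
  | cons i u ih =>
    rw [wordProd_cons, List.length_cons]
    have hx : ((i.val : ℤ) : ZMod n) = i := by simp
    rcases lt_or_gt_of_ne (affineWeyl_apply_ne (wordProd u)⁻¹ i.val) with h | h
    · rw [affineLength_affineRefl_mul_of_lt hx h]; push_cast; omega
    · rw [affineLength_affineRefl_mul_of_gt hx h]; push_cast; omega

/-- Zero total displacement separates the affine Weyl group from the shifts of `ℤ`, which have no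
inversions either. -/
theorem sum_inv_apply_sub (w : AffineWeyl n) : ∑ r : ZMod n, (w⁻¹.1 r.val - r.val) = 0 := by
  obtain ⟨u, rfl⟩ := exists_wordProd w
  induction u with
  | nil => exact Finset.sum_eq_zero fun r _ => sub_self _
  | cons i u ih =>
    have hs : ∀ y k, simpleRefl i (y + n * k) = simpleRefl i y + n * k :=
      affineWeyl_add_mul (affineRefl i)
    have h1 := sum_comp_simpleRefl (F := fun x => (wordProd u)⁻¹.1 x - x)
      (fun x k => by rw [affineWeyl_add_mul]; ring) i
    have h2 := sum_comp_simpleRefl (F := fun x => simpleRefl i x - x)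
      (fun x k => by rw [hs]; ring) i
    -- As `s_i` is an involution, its total displacement now equals its own negative.
    simp only [simpleRefl_simpleRefl] at h2
    rw [ih] at h1
    simp only [wordProd_cons, inv_affineRefl_mul_apply]
    rw [Finset.sum_sub_distrib] at h1 h2 ⊢
    rw [Finset.sum_sub_distrib] at h2
    omega

/-- An increasing bijection of `ℤ` is a shift, and the displacement sum forces the shift to be
trivial. -/
theorem eq_one_of_forall_lt {w : AffineWeyl n} (h : ∀ x, w⁻¹.1 x < w⁻¹.1 (x + 1)) : w = 1 := by
  set v := w⁻¹ with hv
  have hmono : StrictMono v.1 := strictMono_int_of_lt_succ h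
  have hstep : ∀ x, v.1 (x + 1) = v.1 x + 1 := by
    intro x
    obtain ⟨z, hz⟩ := v.1.surjective (v.1 x + 1)
    have h1 : x < z := hmono.lt_iff_lt.1 (by omega)
    have h2 : v.1 (x + 1) ≤ v.1 z := hmono.monotone (by omega)
    have := h x
    omega
  have hshift : ∀ x, v.1 x = x + v.1 0 := by
    intro x
    induction x using Int.induction_on with
    | zero => simp
    | succ k ih => rw [hstep, ih]; ring
    | pred k ih =>
      have := hstep (-(k : ℤ) - 1)
      rw [sub_add_cancel] at this
      omega
  have hsum := sum_inv_apply_sub w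
  rw [← hv] at hsum
  rw [Finset.sum_congr rfl fun (r : ZMod n) _ => show v.1 r.val - r.val = v.1 0 by
    rw [hshift r.val, add_sub_cancel_left]] at hsum
  rw [Finset.sum_const, Finset.card_univ, ZMod.card, nsmul_eq_mul, mul_eq_zero] at hsum
  have h0 := hsum.resolve_left natCast_ne_zero_int
  have : v = 1 := Subtype.ext (Equiv.ext fun x => by rw [hshift, h0, add_zero]; rfl)
  rwa [hv, inv_eq_one] at this

/-- The length of the word is the inversion count of the element it represents. -/
def IsLengthWord (u : List (ZMod n)) : Prop := affineLength (wordProd u) = u.length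

theorem exists_isLengthWord (w : AffineWeyl n) : ∃ u, wordProd u = w ∧ IsLengthWord u := by
  obtain ⟨N, hN⟩ : ∃ N : ℕ, affineLength w = N := Int.eq_ofNat_of_zero_le (affineLength_nonneg w)
  induction N generalizing w with
  | zero =>
    refine ⟨[], ?_, affineLength_one⟩
    symm
    refine eq_one_of_forall_lt fun x => lt_of_not_ge fun hx => ?_
    have h1 := affineLength_affineRefl_mul_of_gt rfl
      (lt_of_le_of_ne hx (affineWeyl_apply_ne _ _).symm)
    have h2 := affineLength_nonneg (affineRefl (x : ZMod n) * w)
    omega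
  | succ N ih =>
    obtain ⟨x, hx⟩ : ∃ x, w⁻¹.1 (x + 1) < w⁻¹.1 x := by
      by_contra! hcon
      have : w = 1 := eq_one_of_forall_lt fun x => lt_of_le_of_ne (hcon x) (affineWeyl_apply_ne _ _)
      rw [this, affineLength_one] at hN
      omega
    have h1 := affineLength_affineRefl_mul_of_gt rfl hx
    obtain ⟨u, hu, hlen⟩ := ih (affineRefl (x : ZMod n) * w) (by omega)
    have h2 : wordProd ((x : ZMod n) :: u) = w := by
      rw [wordProd_cons, hu, affineRefl_mul_cancel]
    refine ⟨(x : ZMod n) :: u, h2, ?_⟩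
    rw [IsLengthWord, hu] at hlen
    rw [IsLengthWord, h2, List.length_cons]
    push_cast; omega

/-- Were the first letter an ascent, deleting it would leave an element longer than the word `u`
allows. -/
theorem IsLengthWord.lt_of_cons {i : ZMod n} {u : List (ZMod n)} (h : IsLengthWord (i :: u))
    {x : ℤ} (hx : (x : ZMod n) = i) :
    (wordProd (i :: u))⁻¹.1 (x + 1) < (wordProd (i :: u))⁻¹.1 x := by
  refine lt_of_le_of_ne (le_of_not_gt fun hlt => ?_) (affineWeyl_apply_ne _ _).symm
  have h1 := affineLength_affineRefl_mul_of_lt hx hlt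
  rw [h, wordProd_cons, affineRefl_mul_cancel] at h1
  have := affineLength_wordProd_le u
  rw [List.length_cons] at h1
  push_cast at h1
  omega

theorem IsLengthWord.of_cons {i : ZMod n} {u : List (ZMod n)} (h : IsLengthWord (i :: u)) :
    IsLengthWord u := by
  have hx : ((i.val : ℤ) : ZMod n) = i := by simp
  have h1 := affineLength_affineRefl_mul_of_gt hx (h.lt_of_cons hx)
  rw [h, wordProd_cons, affineRefl_mul_cancel, List.length_cons] at h1
  rw [IsLengthWord, h1]
  push_cast; ring

/-- Conjugating a simple reflection by an element that maps `x, x + 1` to consecutive integers. -/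
theorem affineRefl_mul_eq_mul_affineRefl {w : AffineWeyl n} {j k : ZMod n} {x : ℤ}
    (hk : (x : ZMod n) = k) (hj : ((w.1 x : ℤ) : ZMod n) = j) (h : w.1 (x + 1) = w.1 x + 1) :
    affineRefl j * w = w * affineRefl k := by
  have hcast : ∀ {y z : ℤ}, ((w.1 y : ℤ) : ZMod n) = (w.1 z : ℤ) → (y : ZMod n) = z := by
    intro y z hyz
    obtain ⟨m, hm⟩ := exists_eq_add_mul hyz
    rw [← affineWeyl_add_mul] at hm
    rw [w.1.injective hm, intCast_add_mul]
  refine Subtype.ext (Equiv.ext fun z => ?_)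
  change simpleRefl j (w.1 z) = w.1 (simpleRefl k z)
  by_cases h1 : (z : ZMod n) = k
  · obtain ⟨m, rfl⟩ := exists_eq_add_mul (h1.trans hk.symm)
    rw [simpleRefl_of_eq h1, affineWeyl_add_mul, simpleRefl_of_eq (by rw [intCast_add_mul, hj]),
      add_right_comm x, affineWeyl_add_mul, h]
    ring
  · by_cases h2 : (z : ZMod n) = k + 1
    · obtain ⟨m, rfl⟩ := exists_eq_add_mul (x := z) (y := x + 1) (by push_cast; rw [h2, hk])
      rw [simpleRefl_of_eq_add_one h2, affineWeyl_add_mul, h,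
        simpleRefl_of_eq_add_one (by rw [intCast_add_mul]; push_cast; rw [hj]),
        show x + 1 + n * m - 1 = x + n * m by ring, affineWeyl_add_mul]
      ring
    · rw [simpleRefl_of_ne h1 h2, simpleRefl_of_ne]
      · intro h3
        exact h1 (hk ▸ hcast (h3.trans hj.symm))
      · intro h3
        refine h2 ?_
        have := hcast (y := z) (z := x + 1) (by rw [h3, h]; push_cast; rw [hj])
        rw [this]; push_cast; rw [hk]

theorem affineRefl_braid {i : ZMod n} (h : i + 1 + 1 ≠ i) :
    affineRefl i * affineRefl (i + 1) * affineRefl i =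
      affineRefl (i + 1) * affineRefl i * affineRefl (i + 1) := by
  have hi : ((i.val : ℤ) : ZMod n) = i := by simp
  have h1 : (affineRefl i * affineRefl (i + 1)).1 (i.val : ℤ) = (i.val : ℤ) + 1 := by
    change simpleRefl i (simpleRefl (i + 1) (i.val : ℤ)) = _
    rw [simpleRefl_of_ne (i := i + 1) (by rw [hi]; simp) (by rw [hi]; exact h.symm),
      simpleRefl_of_eq hi]
  have h2 : (affineRefl i * affineRefl (i + 1)).1 ((i.val : ℤ) + 1) = (i.val : ℤ) + 1 + 1 := by
    change simpleRefl i (simpleRefl (i + 1) ((i.val : ℤ) + 1)) = _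
    rw [simpleRefl_of_eq (i := i + 1) (by push_cast; rw [ZMod.natCast_zmod_val]), simpleRefl_of_ne]
    · push_cast; rw [ZMod.natCast_zmod_val]; exact h
    · push_cast; rw [ZMod.natCast_zmod_val]; simp
  rw [mul_assoc (affineRefl (i + 1))]
  refine (affineRefl_mul_eq_mul_affineRefl hi ?_ (h2.trans (by rw [h1]))).symm
  rw [h1]; push_cast; rw [ZMod.natCast_zmod_val]

theorem affineRefl_comm {i j : ZMod n} (h0 : i ≠ j) (h1 : i + 1 ≠ j) (h2 : j + 1 ≠ i) :
    affineRefl i * affineRefl j = affineRefl j * affineRefl i := by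
  have hi : ((i.val : ℤ) : ZMod n) = i := by simp
  have h3 : i + 1 ≠ j + 1 := fun h => h0 (add_right_cancel h)
  have e1 : (affineRefl j).1 (i.val : ℤ) = i.val :=
    simpleRefl_of_ne (by rwa [hi]) (by rw [hi]; exact h2.symm)
  have e2 : (affineRefl j).1 ((i.val : ℤ) + 1) = i.val + 1 :=
    simpleRefl_of_ne (by push_cast; rwa [ZMod.natCast_zmod_val])
      (by push_cast; rwa [ZMod.natCast_zmod_val])
  exact affineRefl_mul_eq_mul_affineRefl hi (by rw [e1, hi]) (by rw [e1, e2])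

end AffineLength

/-! ### Independence of the reduced word. -/

section DemazureWords

variable {n : ℕ} [Fact (1 < n)]

theorem IsLengthWord.cons {i : ZMod n} {u : List (ZMod n)} (h : IsLengthWord u) {x : ℤ}
    (hx : (x : ZMod n) = i) (hlt : (wordProd u)⁻¹.1 x < (wordProd u)⁻¹.1 (x + 1)) :
    IsLengthWord (i :: u) := by
  rw [IsLengthWord, wordProd_cons, affineLength_affineRefl_mul_of_lt hx hlt, h, List.length_cons]
  push_cast; rfl

/-- Reduced words of the same element beginning with two adjacent letters. -/
theorem foldr_demazure_eq_of_adjacent {N : ℕ}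
    (ih : ∀ u v : List (ZMod n), u.length = N → IsLengthWord u → IsLengthWord v →
      wordProd u = wordProd v → ∀ f : SymSeries n, u.foldr demazure f = v.foldr demazure f)
    {i : ZMod n} {u v : List (ZMod n)} (hlen : u.length = N) (hu : IsLengthWord (i :: u))
    (hv : IsLengthWord ((i + 1) :: v)) (huv : wordProd (i :: u) = wordProd ((i + 1) :: v))
    (f : SymSeries n) :
    (i :: u).foldr demazure f = ((i + 1) :: v).foldr demazure f := by
  obtain ⟨x, hi⟩ : ∃ x : ℤ, (x : ZMod n) = i := ⟨i.val, by simp⟩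
  have hi1 : ((x + 1 : ℤ) : ZMod n) = i + 1 := by push_cast; rw [hi]
  have d1 := hu.lt_of_cons hi
  have d2 := hv.lt_of_cons hi1
  have lu := hu.of_cons
  have lv := hv.of_cons
  rw [← huv] at d2
  set w := wordProd (i :: u) with hw
  -- For `n = 2` descents at both `x` and `x + 1` would contradict periodicity of `w⁻¹`.
  have hne : i + 1 + 1 ≠ i := by
    intro h
    obtain ⟨k, hk⟩ := exists_eq_add_mul (n := n) (x := x + 1 + 1) (y := x)
      (by push_cast; rw [hi, h])
    rw [hk, affineWeyl_add_mul] at d2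
    omega
  have L0 : affineLength w = N + 1 := by
    have h := hu
    rw [IsLengthWord, List.length_cons, hlen] at h
    exact_mod_cast h
  have e1 : wordProd u = affineRefl i * w := by rw [hw, wordProd_cons, affineRefl_mul_cancel]
  have e2 : wordProd v = affineRefl (i + 1) * w := by
    rw [huv, wordProd_cons, affineRefl_mul_cancel]
  have L1 := affineLength_affineRefl_mul_of_gt hi d1
  have L1' := affineLength_affineRefl_mul_of_gt hi1 d2
  have hx2 : simpleRefl i (x + 1 + 1) = x + 1 + 1 :=
    simpleRefl_of_ne (by push_cast; rw [hi]; exact hne) (by push_cast; rw [hi]; simp)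
  have hx1 : simpleRefl i (x + 1) = x := by
    rw [simpleRefl_of_eq_add_one hi1]; ring
  have hx3 : simpleRefl (i + 1) x = x :=
    simpleRefl_of_ne (by rw [hi]; simp) (by rw [hi]; exact hne.symm)
  -- As `w⁻¹` decreases along `x, x + 1, x + 2`, three letters can be stripped from `w`. Prepending
  -- either side of the braid relation to a reduced word `z` of the rest gives reduced words of `w`,
  -- whose tails are compared with `u` and `v` by induction.
  have L2 := affineLength_affineRefl_mul_of_gt (w := affineRefl i * w) hi1 (by
    rw [inv_affineRefl_mul_apply, inv_affineRefl_mul_apply, hx1, hx2]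
    exact d2.trans d1)
  have L3 := affineLength_affineRefl_mul_of_gt (w := affineRefl (i + 1) * (affineRefl i * w)) hi (by
    rw [inv_affineRefl_mul_apply, inv_affineRefl_mul_apply, inv_affineRefl_mul_apply,
      inv_affineRefl_mul_apply, hx3, simpleRefl_of_eq hi1, hx2, simpleRefl_of_eq hi]
    exact d2)
  obtain ⟨z, hz, lz⟩ :=
    exists_isLengthWord (affineRefl i * (affineRefl (i + 1) * (affineRefl i * w)))
  rw [IsLengthWord, hz] at lz
  have p1 : wordProd ((i + 1) :: i :: z) = wordProd u := by
    rw [wordProd_cons, wordProd_cons, hz, affineRefl_mul_cancel, affineRefl_mul_cancel, e1]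
  have p2 : wordProd (i :: (i + 1) :: z) = wordProd v := by
    have h := congrArg (· * (affineRefl (i + 1) * (affineRefl i * w))) (affineRefl_braid hne)
    simp only [mul_assoc, affineRefl_mul_cancel] at h
    rw [wordProd_cons, wordProd_cons, hz, e2, h]
  have q1 := ih u ((i + 1) :: i :: z) hlen lu
    (by rw [IsLengthWord, p1, e1]; simp only [List.length_cons]; push_cast; omega) p1.symm f
  have hlv : v.length = N := by
    have h := lv
    rw [IsLengthWord, e2] at h
    omega
  have q2 := ih v (i :: (i + 1) :: z) hlv lv
    (by rw [IsLengthWord, p2, e2]; simp only [List.length_cons]; push_cast; omega) p2.symm f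
  rw [List.foldr_cons, List.foldr_cons, q1, q2]
  simp only [List.foldr_cons]
  exact demazure_braid hne _

/-- Both letters are descents and do not interact, so both strip off to leave a common `z`; the
words `i j z` and `j i z` link the two given ones. -/
theorem foldr_demazure_eq_of_commuting {N : ℕ}
    (ih : ∀ u v : List (ZMod n), u.length = N → IsLengthWord u → IsLengthWord v →
      wordProd u = wordProd v → ∀ f : SymSeries n, u.foldr demazure f = v.foldr demazure f)
    {i j : ZMod n} (h0 : i ≠ j) (h1 : i + 1 ≠ j) (h2 : j + 1 ≠ i)
    {u v : List (ZMod n)} (hlen : u.length = N) (hu : IsLengthWord (i :: u))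
    (hv : IsLengthWord (j :: v)) (huv : wordProd (i :: u) = wordProd (j :: v))
    (f : SymSeries n) :
    (i :: u).foldr demazure f = (j :: v).foldr demazure f := by
  have hi : ((i.val : ℤ) : ZMod n) = i := by simp
  have hj : ((j.val : ℤ) : ZMod n) = j := by simp
  have h3 : i + 1 ≠ j + 1 := fun h => h0 (add_right_cancel h)
  have d1 := hu.lt_of_cons hi
  have d2 := hv.lt_of_cons hj
  have lu := hu.of_cons
  have lv := hv.of_cons
  rw [← huv] at d2
  set w := wordProd (i :: u) with hw
  have L0 : affineLength w = N + 1 := by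
    have h := hu
    rw [IsLengthWord, List.length_cons, hlen] at h
    exact_mod_cast h
  have e1 : wordProd u = affineRefl i * w := by rw [hw, wordProd_cons, affineRefl_mul_cancel]
  have e2 : wordProd v = affineRefl j * w := by
    rw [huv, wordProd_cons, affineRefl_mul_cancel]
  have L1 := affineLength_affineRefl_mul_of_gt hi d1
  have L1' := affineLength_affineRefl_mul_of_gt hj d2
  have hx1 : simpleRefl i (j.val : ℤ) = j.val :=
    simpleRefl_of_ne (by rw [hj]; exact h0.symm) (by rw [hj]; exact h1.symm)
  have hx2 : simpleRefl i ((j.val : ℤ) + 1) = j.val + 1 :=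
    simpleRefl_of_ne (by push_cast; rw [ZMod.natCast_zmod_val]; exact h2)
      (by push_cast; rw [ZMod.natCast_zmod_val]; exact h3.symm)
  have L2 := affineLength_affineRefl_mul_of_gt (w := affineRefl i * w) hj (by
    rw [inv_affineRefl_mul_apply, inv_affineRefl_mul_apply, hx1, hx2]
    exact d2)
  obtain ⟨z, hz, lz⟩ := exists_isLengthWord (affineRefl j * (affineRefl i * w))
  rw [IsLengthWord, hz] at lz
  have p1 : wordProd (j :: z) = wordProd u := by
    rw [wordProd_cons, hz, affineRefl_mul_cancel, e1]
  have p2 : wordProd (i :: z) = wordProd v := by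
    rw [wordProd_cons, hz, e2, ← mul_assoc (affineRefl j), ← affineRefl_comm h0 h1 h2,
      mul_assoc, affineRefl_mul_cancel]
  have q1 := ih u (j :: z) hlen lu
    (by rw [IsLengthWord, p1, e1]; simp only [List.length_cons]; push_cast; omega) p1.symm f
  have hlv : v.length = N := by
    have h := lv
    rw [IsLengthWord, e2] at h
    omega
  have q2 := ih v (i :: z) hlv lv
    (by rw [IsLengthWord, p2, e2]; simp only [List.length_cons]; push_cast; omega) p2.symm f
  rw [List.foldr_cons, List.foldr_cons, q1, q2]
  simp only [List.foldr_cons]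
  exact demazure_comm h0 h1 h2 _

/-- The composite of Demazure operators along a reduced word depends only on the element. -/
theorem foldr_demazure_eq {u v : List (ZMod n)} (hu : IsLengthWord u) (hv : IsLengthWord v)
    (huv : wordProd u = wordProd v) (f : SymSeries n) :
    u.foldr demazure f = v.foldr demazure f := by
  obtain ⟨N, hN⟩ : ∃ N, u.length = N := ⟨_, rfl⟩
  induction N generalizing u v f with
  | zero =>
    have h : v.length = 0 := by
      have h1 := hu
      rw [IsLengthWord, huv, hv] at h1
      omega
    rw [List.length_eq_zero_iff.1 hN, List.length_eq_zero_iff.1 h]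
  | succ N ih =>
    have h : v.length = N + 1 := by
      have h1 := hu
      rw [IsLengthWord, huv, hv] at h1
      omega
    obtain ⟨i, u, rfl⟩ := List.exists_cons_of_length_eq_add_one hN
    obtain ⟨j, v, rfl⟩ := List.exists_cons_of_length_eq_add_one h
    have ih' : ∀ u v : List (ZMod n), u.length = N → IsLengthWord u → IsLengthWord v →
        wordProd u = wordProd v → ∀ f : SymSeries n, u.foldr demazure f = v.foldr demazure f :=
      fun u v h1 h2 h3 h4 f => ih h2 h3 h4 f h1
    have lu : u.length = N := by simpa using hN
    have lv : v.length = N := by simpa using h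
    by_cases h0 : i = j
    · subst h0
      rw [List.foldr_cons, List.foldr_cons]
      rw [wordProd_cons, wordProd_cons] at huv
      rw [ih hu.of_cons hv.of_cons (mul_left_cancel huv) f lu]
    · by_cases h1 : i + 1 = j
      · subst h1
        exact foldr_demazure_eq_of_adjacent ih' lu hu hv huv f
      · by_cases h2 : j + 1 = i
        · subst h2
          exact (foldr_demazure_eq_of_adjacent ih' lv hv hu huv.symm f).symm
        · exact foldr_demazure_eq_of_commuting ih' h0 h1 h2 lu hu hv huv f

theorem demazureElt_wordProd {u : List (ZMod n)} (hu : IsLengthWord u) (f : SymSeries n) :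
    demazureElt (wordProd u) f = u.foldr demazure f := by
  obtain ⟨h1, h2⟩ := (exists_isReducedWord (wordProd u)).choose_spec
  refine foldr_demazure_eq ?_ hu h1 f
  -- The chosen word is shortest, hence no longer than `u`, whose length is the inversion count.
  refine le_antisymm (affineLength_wordProd_le _) ?_
  rw [h1, hu]
  exact_mod_cast h2 u rfl

end DemazureWords

/-! ### Residue words: reducedness and passage through rectangles. -/

section Partitions

variable {n : ℕ}

theorem residueWord_append (r : ℕ) (xs ys : List ℕ) :
    residueWord n r (xs ++ ys) = residueWord n (r + xs.length) ys ++ residueWord n r xs := by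
  induction xs generalizing r with
  | nil => simp [residueWord]
  | cons p ps ih =>
    rw [List.cons_append, residueWord, residueWord, ih, List.append_assoc, List.length_cons,
      add_assoc, add_comm 1]

theorem length_residueWord (r : ℕ) (xs : List ℕ) : (residueWord n r xs).length = xs.sum := by
  induction xs generalizing r with
  | nil => rfl
  | cons p ps ih => simp [residueWord, ih, add_comm]

/-- Moving down `n - i` rows lowers residues by `n - i`, that is, raises them by `i` modulo `n`. -/
theorem residueWord_add_sub {i : ℕ} (hi : i ≤ n) (r : ℕ) (xs : List ℕ) :
    residueWord n (r + (n - i)) xs = (residueWord n r xs).map (· + (i : ZMod n)) := by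
  induction xs generalizing r with
  | nil => rfl
  | cons p ps ih =>
    rw [residueWord, residueWord, List.map_append, ← ih, add_right_comm, List.map_map]
    congr 2
    funext c
    simp only [Function.comp]
    push_cast [Nat.cast_sub hi]
    rw [ZMod.natCast_self]
    ring

/-- The residues of a row of length `p` in row number `r`, from right to left. -/
def rowWord (n r p : ℕ) : List (ZMod n) := (List.range p).reverse.map fun c => (c : ZMod n) - r

theorem rowWord_succ (r p : ℕ) : rowWord n r (p + 1) = ((p : ZMod n) - r) :: rowWord n r p := by
  simp [rowWord, List.range_succ]

theorem residueWord_cons (r p : ℕ) (ps : List ℕ) :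
    residueWord n r (p :: ps) = residueWord n (r + 1) ps ++ rowWord n r p := rfl

theorem intCast_ne {a b : ℤ} (h : a ≠ b) (h' : |a - b| < n) : (a : ZMod n) ≠ b := by
  intro e
  obtain ⟨k, hk⟩ := exists_eq_add_mul e
  have h1 : (n : ℤ) ∣ a - b := ⟨k, by linear_combination hk⟩
  exact h (sub_eq_zero.1 (Int.eq_zero_of_abs_lt_dvd h1 h'))

variable [Fact (1 < n)]

/-- Integers are written as `n q + y - r` with `1 ≤ y ≤ n` in the applications; in this frame for
row `r` the letter `p - r` exchanges the positions `p` and `p + 1`. -/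
theorem simpleRefl_frame_eq (p r : ℕ) (q y : ℤ) (hy : y = p) :
    simpleRefl ((p : ZMod n) - (r : ZMod n)) (n * q + y - r) = n * q + y - r + 1 :=
  simpleRefl_of_eq (by subst hy; push_cast; simp)

theorem simpleRefl_frame_eq_add_one (p r : ℕ) (q y : ℤ) (hy : y = p + 1) :
    simpleRefl ((p : ZMod n) - (r : ZMod n)) (n * q + y - r) = n * q + y - r - 1 :=
  simpleRefl_of_eq_add_one (by subst hy; push_cast; simp; ring)

theorem simpleRefl_frame_ne (p r : ℕ) (q y : ℤ) (h1 : y ≠ p) (h2 : y ≠ p + 1)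
    (h3 : |y - p| < n) (h4 : |y - (p + 1)| < n) :
    simpleRefl ((p : ZMod n) - (r : ZMod n)) (n * q + y - r) = n * q + y - r := by
  refine simpleRefl_of_ne ?_ ?_
  · have := intCast_ne h1 h3
    push_cast at this ⊢
    simpa [sub_left_inj] using this
  · have := intCast_ne h2 h4
    push_cast at this ⊢
    intro e
    apply this
    simp at e
    linear_combination e

/-- A row acts as a cycle on each window of length `n`. -/
theorem rowWord_apply {p : ℕ} (hp : p < n) (r : ℕ) (q y : ℤ) (h1 : 1 ≤ y) (h2 : y ≤ n) :
    (wordProd (rowWord n r p)).1 (n * q + y - r) =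
      if y ≤ p then n * q + y - r - 1 else if y = n then n * q + y - r + p
        else n * q + y - r := by
  induction p with
  | zero =>
    rw [if_neg (by push_cast; omega)]
    change n * q + y - r = _
    simp
  | succ p ih =>
    rw [rowWord_succ, wordProd_cons]
    change simpleRefl _ ((wordProd (rowWord n r p)).1 _) = _
    rw [ih (by omega)]
    push_cast
    by_cases c1 : y ≤ p
    · rw [if_pos c1, if_pos (by omega), show (n : ℤ) * q + y - r - 1 = n * q + (y - 1) - r by ring]
      exact simpleRefl_frame_ne _ _ _ _ (by omega) (by omega) (by rw [abs_lt]; omega)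
        (by rw [abs_lt]; omega)
    · rw [if_neg c1]
      by_cases c2 : y = p + 1
      · rw [if_neg (by omega), if_pos (by omega)]
        exact simpleRefl_frame_eq_add_one _ _ _ _ c2
      · rw [if_neg (c := y ≤ (p : ℤ) + 1) (by omega)]
        by_cases c3 : y = n
        · rw [if_pos c3, if_pos c3, show (n : ℤ) * q + y - r + p = n * (q + 1) + p - r by
            rw [c3]; ring, simpleRefl_frame_eq _ _ _ _ rfl]
          rw [c3]; ring
        · rw [if_neg c3, if_neg c3]
          exact simpleRefl_frame_ne _ _ _ _ (by omega) (by omega) (by rw [abs_lt]; omega)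
            (by rw [abs_lt]; omega)

theorem exists_frame (r : ℕ) (z : ℤ) : ∃ q y : ℤ, 1 ≤ y ∧ y ≤ n ∧ z = n * q + y - r := by
  have hn := Fact.out (p := 1 < n)
  have h1 := Int.emod_add_mul_ediv (z + r - 1) n
  have h2 := Int.emod_nonneg (z + r - 1) (natCast_ne_zero_int (n := n))
  have h3 := Int.emod_lt_of_pos (z + r - 1) (b := n) (by omega)
  refine ⟨(z + r - 1) / n, (z + r - 1) % n + 1, by omega, by omega, ?_⟩
  linear_combination -h1

theorem rowWord_apply_neg {p : ℕ} (hp : p < n) (r : ℕ) :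
    (wordProd (rowWord n r p)).1 (-r) = p - r := by
  have hn := Fact.out (p := 1 < n)
  have := rowWord_apply hp r (-1) n (by omega) le_rfl
  rw [if_neg (by omega), if_pos rfl] at this
  rw [show (n : ℤ) * (-1) + n - r = -r by ring] at this
  rw [this]; ring

theorem rowWord_inv_apply_of_lt {p : ℕ} (hp : p < n) (r : ℕ) {y : ℤ} (h0 : 0 ≤ y) (h1 : y < p) :
    (wordProd (rowWord n r p))⁻¹.1 (y - r) = y + 1 - r := by
  have := rowWord_apply hp r 0 (y + 1) (by omega) (by omega)
  rw [if_pos (by omega), mul_zero, zero_add, show y + 1 - r - 1 = y - r by ring] at this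
  rw [← this]
  exact Equiv.symm_apply_apply _ _

theorem rowWord_inv_apply_le {p : ℕ} (hp : p < n) (r : ℕ) {x : ℤ} (hx : x < -r) :
    (wordProd (rowWord n r p))⁻¹.1 x ≤ -r := by
  have hn := Fact.out (p := 1 < n)
  obtain ⟨z, rfl⟩ := (wordProd (rowWord n r p)).1.surjective x
  have e : (wordProd (rowWord n r p))⁻¹.1 ((wordProd (rowWord n r p)).1 z) = z :=
    Equiv.symm_apply_apply _ _
  rw [e]
  by_contra! hz
  obtain ⟨q, y, h1, h2, rfl⟩ := exists_frame (n := n) r z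
  rw [rowWord_apply hp r q y h1 h2] at hx
  have hq : 0 ≤ q := by
    by_contra! hq
    have : (n : ℤ) * q ≤ n * (-1) := mul_le_mul_of_nonneg_left (by omega) (by omega)
    omega
  have : 0 ≤ (n : ℤ) * q := by positivity
  split_ifs at hx <;> omega

theorem inv_wordProd_append_apply (u v : List (ZMod n)) (x : ℤ) :
    (wordProd (u ++ v))⁻¹.1 x = (wordProd v)⁻¹.1 ((wordProd u)⁻¹.1 x) := by
  rw [wordProd_append, mul_inv_rev]; rfl

/-- The first `p` letters of the row carry `-r` to `p - r` and fix `p + 1 - r`, so adding the next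
letter requires exactly the comparison `h` at `j = p + 1`. -/
theorem isLengthWord_rowWord_append {u : List (ZMod n)} (hu : IsLengthWord u) {r m : ℕ}
    (hm : m < n)
    (h : ∀ j : ℤ, 1 ≤ j → j ≤ m → (wordProd u)⁻¹.1 (-r) < (wordProd u)⁻¹.1 (j - r)) :
    IsLengthWord (rowWord n r m ++ u) := by
  suffices ∀ p ≤ m, IsLengthWord (rowWord n r p ++ u) from this m le_rfl
  intro p
  induction p with
  | zero => intro _; exact hu
  | succ p ih =>
    intro hp
    rw [rowWord_succ, List.cons_append]
    refine (ih (by omega)).cons (x := p - r) (by push_cast; rfl) ?_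
    rw [inv_wordProd_append_apply, inv_wordProd_append_apply]
    have e1 : (wordProd (rowWord n r p))⁻¹.1 (p - r) = -r := by
      rw [← rowWord_apply_neg (by omega : p < n)]
      exact Equiv.symm_apply_apply _ _
    have e2 : (wordProd (rowWord n r p))⁻¹.1 (p - r + 1) = p + 1 - r := by
      have := rowWord_apply (by omega : p < n) r 0 (p + 1) (by omega) (by omega)
      rw [if_neg (by omega), if_neg (by omega), mul_zero, zero_add] at this
      rw [show (p : ℤ) - r + 1 = p + 1 - r by ring]
      conv_lhs => rw [← this]
      exact Equiv.symm_apply_apply _ _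
    rw [e1, e2]
    exact h _ (by omega) (by exact_mod_cast hp)

/-- The hypotheses `h1` and `h2` are the invariant carried from row to row. They make every letter
of the next row an ascent, since `-r` goes to something nonpositive and `j - r` to `j > 0`; they
persist because the rows do not grow. -/
theorem isLengthWord_residueWord_append {ps : List ℕ} (hps : ps.Pairwise (· ≥ ·)) {m : ℕ}
    (hm : m < n) (hle : ∀ p ∈ ps, p ≤ m) (r : ℕ) {u : List (ZMod n)} (hu : IsLengthWord u)
    (h1 : ∀ j : ℤ, 1 ≤ j → j ≤ m → (wordProd u)⁻¹.1 (j - r) = j)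
    (h2 : ∀ x : ℤ, x ≤ -r → (wordProd u)⁻¹.1 x ≤ 0) :
    IsLengthWord (residueWord n r ps ++ u) := by
  induction ps generalizing m r u with
  | nil => exact hu
  | cons p ps ih =>
    rw [residueWord_cons, List.append_assoc]
    have hpm : p ≤ m := hle p (by simp)
    rw [List.pairwise_cons] at hps
    refine ih hps.2 (m := p) (by omega) (fun q hq => hps.1 q hq) (r + 1) ?_ ?_ ?_
    · refine isLengthWord_rowWord_append hu (by omega) fun j hj hj' => ?_
      rw [h1 j hj (by omega)]
      have := h2 _ (le_refl (-(r : ℤ)))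
      omega
    · intro j hj hj'
      rw [inv_wordProd_append_apply,
        show j - ((r + 1 : ℕ) : ℤ) = (j - 1) - r by push_cast; ring,
        rowWord_inv_apply_of_lt (by omega) r (by omega) (by omega), sub_add_cancel]
      exact h1 j hj (by omega)
    · intro x hx
      rw [inv_wordProd_append_apply]
      push_cast at hx
      exact h2 _ (rowWord_inv_apply_le (by omega) r (by omega))

theorem isLengthWord_residueWord {ps : List ℕ} (hps : ps.Pairwise (· ≥ ·))
    (hlt : ∀ p ∈ ps, p < n) : IsLengthWord (residueWord n 0 ps) := by
  have hn := Fact.out (p := 1 < n)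
  have hone : (wordProd ([] : List (ZMod n)))⁻¹ = 1 := inv_one
  have := isLengthWord_residueWord_append (n := n) hps (m := n - 1) (by omega)
    (fun p hp => by have := hlt p hp; omega) 0 (u := []) affineLength_one
    (fun j _ _ => by rw [hone]; change j - ((0 : ℕ) : ℤ) = j; simp)
    (fun x hx => by rw [hone]; change x ≤ 0; simpa using hx)
  rwa [List.append_nil] at this

theorem simpleRefl_add (j : ZMod n) (c : ℕ) (x : ℤ) :
    simpleRefl (j + (c : ZMod n)) x = simpleRefl j (x - c) + c := by
  by_cases h : (x : ZMod n) = j + c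
  · rw [simpleRefl_of_eq h, simpleRefl_of_eq (by push_cast; rw [h]; ring)]; ring
  · by_cases h' : (x : ZMod n) = j + c + 1
    · rw [simpleRefl_of_eq_add_one h', simpleRefl_of_eq_add_one (by push_cast; rw [h']; ring)]
      ring
    · rw [simpleRefl_of_ne h h', simpleRefl_of_ne]
      · ring
      · push_cast; intro e; exact h (by linear_combination e)
      · push_cast; intro e; exact h' (by linear_combination e)

/-- The word with every letter increased by `c`. -/
abbrev shiftWord (c : ℕ) (u : List (ZMod n)) : List (ZMod n) := u.map (· + (c : ZMod n))

theorem wordProd_shiftWord_apply (c : ℕ) (u : List (ZMod n)) (x : ℤ) :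
    (wordProd (shiftWord c u)).1 x = (wordProd u).1 (x - c) + c := by
  induction u with
  | nil => change x = x - c + c; ring
  | cons j u ih =>
    rw [shiftWord, List.map_cons, wordProd_cons, wordProd_cons]
    change simpleRefl _ ((wordProd (shiftWord c u)).1 x) = simpleRefl j ((wordProd u).1 (x - c)) + c
    rw [ih, simpleRefl_add, add_sub_cancel_right]

/-- The residues of the rectangle `(i)^{n-i}` whose first row is row number `r`. -/
def rectangleWord (n i r : ℕ) : List (ZMod n) := residueWord n r (List.replicate (n - i) i)

theorem residueWord_replicate_apply {i k : ℕ} (h0 : 1 ≤ i) (hk : k ≤ n - i) (r : ℕ)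
    (q y : ℤ) (h1 : 1 ≤ y) (h2 : y ≤ n) (hn : i < n) :
    (wordProd (residueWord n r (List.replicate k i))).1 (n * q + y - r) =
      if y ≤ i then n * q + y - r - k else if n - k < y then n * q + y - r + i
        else n * q + y - r := by
  induction k with
  | zero =>
    change n * q + y - r = _
    split_ifs
    · push_cast; ring
    · push_cast at *; omega
    · rfl
  | succ k ih =>
    rw [List.replicate_succ', residueWord_append, wordProd_append, List.length_replicate]
    change (wordProd (rowWord n (r + k) i)).1 ((wordProd (residueWord n r _)).1 _) = _
    rw [ih (by omega)]
    by_cases c1 : y ≤ i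
    · rw [if_pos c1, if_pos c1,
        show (n : ℤ) * q + y - r - k = n * q + y - ((r + k : ℕ) : ℤ) by push_cast; ring,
        rowWord_apply hn _ _ _ h1 h2, if_pos c1]
      push_cast; ring
    · rw [if_neg c1, if_neg c1]
      by_cases c2 : (n : ℤ) - k < y
      -- Positions already raised lie, in the frame of the new row, strictly between `i` and `n`,
      -- where that row acts trivially.
      · rw [if_pos c2, if_pos (by push_cast; omega),
          show (n : ℤ) * q + y - r + i = n * (q + 1) + (y + i + k - n) - ((r + k : ℕ) : ℤ) by
            push_cast; ring,
          rowWord_apply hn _ _ _ (by omega) (by omega), if_neg (by omega), if_neg (by omega)]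
      · rw [if_neg c2,
          show (n : ℤ) * q + y - r = n * q + (y + k) - ((r + k : ℕ) : ℤ) by push_cast; ring,
          rowWord_apply hn _ _ _ (by omega) (by omega), if_neg (by omega)]
        push_cast
        congr 1
        rw [eq_iff_iff]
        omega

theorem rectangleWord_apply {i : ℕ} (h0 : 1 ≤ i) (hn : i < n) (r : ℕ) (q y : ℤ) (h1 : 1 ≤ y)
    (h2 : y ≤ n) :
    (wordProd (rectangleWord n i r)).1 (n * q + y - r) =
      if y ≤ i then n * q + y - r + i - n else n * q + y - r + i := by
  rw [rectangleWord, residueWord_replicate_apply h0 le_rfl r q y h1 h2 hn]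
  by_cases c : y ≤ i
  · rw [if_pos c, if_pos c, Nat.cast_sub hn.le]; ring
  · rw [if_neg c, if_neg c, if_pos (by omega)]

/-- The rectangle is a shift by `i` up to lowering positions `1, …, i` by `n`. As `i ≤ m`, the row
moves all those positions in the same way, down by one, which the frame of row `r + 1` absorbs. -/
theorem rectangleWord_mul_rowWord {i m : ℕ} (h0 : 1 ≤ i) (him : i ≤ m) (hm : m < n) (r : ℕ) :
    wordProd (rectangleWord n i (r + 1)) * wordProd (rowWord n r m) =
      wordProd (shiftWord i (rowWord n r m)) * wordProd (rectangleWord n i r) := by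
  have hn : i < n := by omega
  refine Subtype.ext (Equiv.ext fun z => ?_)
  change (wordProd (rectangleWord n i (r + 1))).1 ((wordProd (rowWord n r m)).1 z) =
    (wordProd (shiftWord i (rowWord n r m))).1 ((wordProd (rectangleWord n i r)).1 z)
  obtain ⟨q, y, h1, h2, rfl⟩ := exists_frame (n := n) r z
  rw [wordProd_shiftWord_apply, rowWord_apply hm r q y h1 h2,
    rectangleWord_apply h0 hn r q y h1 h2]
  by_cases c1 : y ≤ i
  · rw [if_pos (by omega), if_pos c1,
      show (n : ℤ) * q + y - r + i - n - i = n * (q - 1) + y - r by ring,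
      rowWord_apply hm r _ y h1 h2, if_pos (by omega),
      show (n : ℤ) * q + y - r - 1 = n * q + y - ((r + 1 : ℕ) : ℤ) by push_cast; ring,
      rectangleWord_apply h0 hn _ _ _ h1 h2, if_pos c1]
    push_cast; ring
  · rw [if_neg c1, add_sub_cancel_right, rowWord_apply hm r _ y h1 h2]
    by_cases c2 : y ≤ m
    · rw [if_pos c2,
        show (n : ℤ) * q + y - r - 1 = n * q + y - ((r + 1 : ℕ) : ℤ) by push_cast; ring,
        rectangleWord_apply h0 hn _ _ _ h1 h2, if_neg c1]
    · rw [if_neg c2]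
      -- The last position wraps to position `m + 1` of the next window, in the frame of row `r +
      -- 1`; it exceeds `i`, so it is not lowered.
      by_cases c3 : y = n
      · rw [if_pos c3,
          show (n : ℤ) * q + y - r + m = n * (q + 1) + (m + 1) - ((r + 1 : ℕ) : ℤ) by
            rw [c3]; push_cast; ring,
          rectangleWord_apply h0 hn _ _ _ (by omega) (by omega), if_neg (by omega)]
      · rw [if_neg c3,
          show (n : ℤ) * q + y - r = n * q + (y + 1) - ((r + 1 : ℕ) : ℤ) by push_cast; ring,
          rectangleWord_apply h0 hn _ _ _ (by omega) (by omega), if_neg (by omega)]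

theorem rectangleWord_mul_residueWord {i : ℕ} (h0 : 1 ≤ i) {ps : List ℕ}
    (hps : ∀ p ∈ ps, i ≤ p ∧ p < n) (r : ℕ) :
    wordProd (rectangleWord n i (r + ps.length)) * wordProd (residueWord n r ps) =
      wordProd (shiftWord i (residueWord n r ps)) * wordProd (rectangleWord n i r) := by
  induction ps generalizing r with
  | nil => simp [residueWord, wordProd]
  | cons p ps ih =>
    have hp := hps p (by simp)
    rw [residueWord_cons, shiftWord, List.map_append, wordProd_append, wordProd_append,
      List.length_cons, show r + (ps.length + 1) = r + 1 + ps.length by ring, ← mul_assoc,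
      ih (fun q hq => hps q (by simp [hq])), mul_assoc, rectangleWord_mul_rowWord h0 hp.1 hp.2,
      mul_assoc]

end Partitions

/-! ### The word of `λ ∪ R_i` and the invariance of the rectangle series. -/

section Factorization

variable {n : ℕ}

theorem sort_ge_add {A B : Multiset ℕ} (h : ∀ a ∈ A, ∀ b ∈ B, b ≤ a) :
    (A + B).sort (· ≥ ·) = A.sort (· ≥ ·) ++ B.sort (· ≥ ·) := by
  refine List.Perm.eq_of_pairwise' (r := (· ≥ ·)) (Multiset.pairwise_sort _ _) ?_ ?_
  · rw [List.pairwise_append]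
    exact ⟨Multiset.pairwise_sort _ _, Multiset.pairwise_sort _ _, fun a ha b hb =>
      h a ((Multiset.mem_sort _).1 ha) b ((Multiset.mem_sort _).1 hb)⟩
  · rw [← Multiset.coe_eq_coe, ← Multiset.coe_add, Multiset.sort_eq, Multiset.sort_eq,
      Multiset.sort_eq]

theorem sort_ge_replicate (k i : ℕ) :
    (Multiset.replicate k i).sort (· ≥ ·) = List.replicate k i := by
  refine List.eq_replicate_iff.2 ⟨by simp, fun b hb => ?_⟩
  exact Multiset.eq_of_mem_replicate ((Multiset.mem_sort _).1 hb)

/-- The residue word of a bounded partition. -/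
def BoundedPartition.word (lam : BoundedPartition n) : List (ZMod n) :=
  residueWord n 0 (lam.parts.sort (· ≥ ·))

theorem rectangle_word {i : ℕ} (h1 : 1 ≤ i) (hn : i ≤ n - 1) :
    (rectangle h1 hn).word = rectangleWord n i 0 := by
  rw [BoundedPartition.word, rectangle, sort_ge_replicate, rectangleWord]

variable [Fact (1 < n)]

theorem BoundedPartition.isLengthWord_word (lam : BoundedPartition n) : IsLengthWord lam.word :=
  isLengthWord_residueWord (Multiset.pairwise_sort _ _)
    fun p hp => lam.lt p ((Multiset.mem_sort _).1 hp)

theorem gTilde_eq_foldr (lam : BoundedPartition n) : gTilde lam = lam.word.foldr demazure 1 :=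
  demazureElt_wordProd lam.isLengthWord_word 1

/-- The rectangle is inserted between the rows `A` of length at least `i` and the shorter rows `B`.
It pushes `B` down by `n - i` rows, raising residues by `i`, and its word is then moved past that of
`A`, which raises those residues too. -/
theorem wordProd_union_rectangle (lam : BoundedPartition n) {i : ℕ} (h1 : 1 ≤ i)
    (hn : i ≤ n - 1) :
    wordProd (lam.union (rectangle h1 hn)).word =
      wordProd (shiftWord i lam.word ++ (rectangle h1 hn).word) := by
  set A := lam.parts.filter (i ≤ ·) with hA
  set B := lam.parts.filter (¬ i ≤ ·) with hB
  have hAB : lam.parts = A + B := (Multiset.filter_add_not _ _).symm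
  have hmA : ∀ a ∈ A, i ≤ a ∧ a < n := fun a ha =>
    ⟨(Multiset.mem_filter.1 ha).2, lam.lt a (Multiset.mem_filter.1 ha).1⟩
  have hmB : ∀ b ∈ B, b < i := fun b hb => not_le.1 (Multiset.mem_filter.1 hb).2
  have hR : ∀ b ∈ Multiset.replicate (n - i) i, b = i := fun b => Multiset.eq_of_mem_replicate
  have e1 : lam.parts.sort (· ≥ ·) = A.sort (· ≥ ·) ++ B.sort (· ≥ ·) := by
    rw [hAB]
    exact sort_ge_add fun a ha b hb => (hmB b hb).le.trans (hmA a ha).1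
  have e2 : (lam.union (rectangle h1 hn)).parts.sort (· ≥ ·) =
      A.sort (· ≥ ·) ++ (List.replicate (n - i) i ++ B.sort (· ≥ ·)) := by
    have : (lam.union (rectangle h1 hn)).parts = A + (Multiset.replicate (n - i) i + B) := by
      change lam.parts + Multiset.replicate (n - i) i = _
      rw [hAB, add_assoc, add_comm B]
    rw [this, sort_ge_add, sort_ge_add, sort_ge_replicate]
    · intro a ha b hb
      rw [hR a ha]
      exact (hmB b hb).le
    · intro a ha b hb
      rcases Multiset.mem_add.1 hb with hb | hb
      · rw [hR b hb]
        exact (hmA a ha).1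
      · exact (hmB b hb).le.trans (hmA a ha).1
  rw [wordProd_append, rectangle_word, BoundedPartition.word, BoundedPartition.word, e1, e2]
  simp only [residueWord_append, List.length_replicate, shiftWord, List.map_append, wordProd_append,
    zero_add]
  rw [residueWord_add_sub (by omega), mul_assoc, mul_assoc]
  congr 1
  have := rectangleWord_mul_residueWord h1 (ps := A.sort (· ≥ ·))
    (fun p hp => hmA p ((Multiset.mem_sort _).1 hp)) 0
  rwa [zero_add] at this

/-- It has as many letters as the residue word of the union, which is reduced and represents the
same element. -/
theorem isLengthWord_shiftWord_append (lam : BoundedPartition n) {i : ℕ} (h1 : 1 ≤ i)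
    (hn : i ≤ n - 1) :
    IsLengthWord (shiftWord i lam.word ++ (rectangle h1 hn).word) := by
  have h := (lam.union (rectangle h1 hn)).isLengthWord_word
  rw [IsLengthWord, wordProd_union_rectangle] at h
  rw [IsLengthWord, h]
  have hs : ∀ mu : BoundedPartition n, mu.word.length = mu.parts.sum := fun mu => by
    rw [BoundedPartition.word, length_residueWord, ← Multiset.sum_coe, Multiset.sort_eq]
  rw [List.length_append, List.length_map, hs, hs, hs, ← Multiset.sum_add]
  rfl

/-- The series of a rectangle is fixed by all Demazure operators but one. -/
theorem demazure_gTilde_rectangle {i : ℕ} (h1 : 1 ≤ i) (hn : i ≤ n - 1) {j : ZMod n}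
    (hj : j ≠ i) : demazure j (gTilde (rectangle h1 hn)) = gTilde (rectangle h1 hn) := by
  have hin : i < n := by omega
  rw [gTilde_eq_foldr]
  have hu := (rectangle h1 hn).isLengthWord_word
  rw [rectangle_word] at hu ⊢
  set u := rectangleWord n i 0
  have happ : ∀ y : ℤ, 1 ≤ y → y ≤ n → (wordProd u).1 y = if y ≤ i then y + i - n else y + i := by
    intro y hy1 hy2
    simpa using rectangleWord_apply h1 hin 0 0 y hy1 hy2
  have hinv : ∀ x y : ℤ, (wordProd u).1 x = y → (wordProd u)⁻¹.1 y = x := by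
    rintro x y rfl
    exact Equiv.symm_apply_apply _ _
  set k := j - (i : ZMod n) with hk
  have hk0 : k ≠ 0 := sub_ne_zero.2 hj
  have hy1 : 1 ≤ k.val := Nat.one_le_iff_ne_zero.2 (by rwa [Ne, ZMod.val_eq_zero])
  have hy2 := k.val_lt
  obtain ⟨y, hy⟩ : ∃ y : ℤ, y = k.val := ⟨_, rfl⟩
  have hyk : (y : ZMod n) = k := by rw [hy]; simp
  -- Here `j = 2i`, and `s_j` is a left descent of the rectangle element: some reduced word starts
  -- with `j`, and `D_j` is idempotent.
  by_cases c : y = i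
  · have hjv : ((2 * i - n : ℤ) : ZMod n) = j := by
      have : (i : ZMod n) = k := by rw [← hyk, c]; simp
      push_cast
      rw [ZMod.natCast_self]
      linear_combination this + hk
    have a1 : (wordProd u)⁻¹.1 (2 * i - n) = i := hinv _ _ (by
      rw [happ _ (by omega) (by omega), if_pos le_rfl]; ring)
    have a2 : (wordProd u)⁻¹.1 (2 * i - n + 1) = i + 1 - n := hinv _ _ (by
      have := affineWeyl_add_mul (wordProd u) (i + 1) (-1)
      rw [happ (i + 1) (by omega) (by omega), if_neg (by omega)] at this
      rw [show (i : ℤ) + 1 - n = i + 1 + n * (-1) by ring, this]; ring)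
    have hlt := affineLength_affineRefl_mul_of_gt hjv (w := wordProd u) (by rw [a1, a2]; omega)
    obtain ⟨z, hz, lz⟩ := exists_isLengthWord (affineRefl j * wordProd u)
    have hzu : wordProd (j :: z) = wordProd u := by rw [wordProd_cons, hz, affineRefl_mul_cancel]
    have lz' : IsLengthWord (j :: z) := by
      rw [IsLengthWord, hz] at lz
      rw [IsLengthWord, hzu, List.length_cons]
      push_cast; omega
    rw [← foldr_demazure_eq lz' hu hzu, List.foldr_cons, demazure_demazure]
  -- Now `y` and `y + 1` lie on the same side of the break at `i`, so `s_j` passes through the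
  -- rectangle to become `s_k` with `k = j - i ≠ 0`, and `D_k` fixes `1`.
  · have hstep : (wordProd u).1 (y + 1) = (wordProd u).1 y + 1 := by
      rw [happ _ (by omega) (by omega), happ _ (by omega) (by omega)]
      split_ifs <;> omega
    have hval : (((wordProd u).1 y : ℤ) : ZMod n) = j := by
      rw [happ _ (by omega) (by omega)]
      split_ifs <;> push_cast <;> rw [hyk, hk] <;> simp
    have hcomm := affineRefl_mul_eq_mul_affineRefl hyk hval hstep
    have lj : IsLengthWord (j :: u) := hu.cons hval (by
      rw [hinv _ _ rfl, ← hstep, hinv _ _ rfl]; omega)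
    have hw : wordProd (j :: u) = wordProd (u ++ [k]) := by
      rw [wordProd_cons, hcomm, wordProd_append]
      congr 1
    have lk : IsLengthWord (u ++ [k]) := by
      rw [IsLengthWord, ← hw, lj]; simp
    have := foldr_demazure_eq lj lk hw 1
    rwa [List.foldr_cons, List.foldr_append, List.foldr_cons, List.foldr_nil,
      demazure_one hk0] at this

end Factorization

end KSchur

end

theorem mainTheorem3 (n : ℕ) [Fact (1 < n)] (lam : KSchur.BoundedPartition n) (i : ℕ)
    (h1 : 1 ≤ i) (hn : i ≤ n - 1) :
    KSchur.gTilde (lam.union (KSchur.rectangle h1 hn)) =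
      KSchur.permSeries (KSchur.cyc n ^ i) (KSchur.gTilde lam) *
        KSchur.gTilde (KSchur.rectangle h1 hn) := by
  open KSchur in
  have hfix := fun (j : ZMod n) (hj : j ≠ i) => demazure_gTilde_rectangle h1 hn hj
  rw [gTilde_eq_foldr (lam.union _), foldr_demazure_eq (BoundedPartition.isLengthWord_word _)
    (isLengthWord_shiftWord_append lam h1 hn) (wordProd_union_rectangle lam h1 hn),
    List.foldr_append, ← gTilde_eq_foldr, gTilde_eq_foldr lam]
  -- From here the identity holds for an arbitrary word; reducedness has already been used.
  induction lam.word with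
  | nil => simp
  | cons j u ih =>
    rw [shiftWord, List.map_cons, List.foldr_cons, List.foldr_cons, ih,
      demazure_cyc_pow_mul h1 (by omega) hfix]
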